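/- **Setting.** A finite directed graph $G$ has finite sets $G^0$ of vertices and $G^1$ of edges and maps $i,t:G^1\to G^0$ (initial and terminal vertex); it is primitive if some positive power of its adjacency matrix has only positive entries. $X_G^+$ and $X_G$ are the spaces of one-sided paths $(x_1,x_2,\dots)$ and of bi-infinite paths $(x_n)_{n\in\mathbb Z}$ in $G$ (that is, $t(x_n)=i(x_{n+1})$), with the product topology, the shift $\sigma(x)_n=x_{n+1}$ and the metrics $d_G(x,y)=\inf\{2^{-n}: n\ge 0,\ x_j=y_j \text{ for } 1\le j\le n\}$ on $X_G^+$ and $d_G(x,y)=\inf\{2^{-n}: n\ge 0,\ x_j=y_j\text{ for }1-n\le j\le n\}$ on $X_G$. On $X_G$ put $[x,y]=(\dots,y_{-1},y_0,x_1,x_2,\dots)$, defined when $d_G(x,y)\le 2^{-1}$. Let $G,H$ be finite directed graphs with $G$ primitive and let $\xi^0,\xi^1:H\to G$ be injective graph homomorphisms such that (H0) $\xi^0=\xi^1$ on $H^0$; (H1) $\xi^0(H^1)\cap\xi^1(H^1)=\emptyset$; (H2) for each $y\in H^1$ there is an edge $x\in G^1\setminus\xi(H^1)$ with $i(x)=i(\xi^0(y))$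 and $t(x)=t(\xi^0(y))$, where $\xi(H^1)=\xi^0(H^1)\cup\xi^1(H^1)$. Assume also that $X_H\neq\emptyset$. *The one-sided factor.* On $X_G^+$ let $x\sim_\xi x'$ if $x=x'$, or if for some $i\in\{0,1\}$ and edges $y_k$ of $H$ one of the following holds: (1) for some $n\ge1$, $x_k=x'_k$ for $k<n$, $x_n=\xi^{1-i}(y_n)$, $x'_n=\xi^i(y_n)$, and $x_k=\xi^i(y_k)$, $x'_k=\xi^{1-i}(y_k)$ for $k>n$; (2) for some $n\ge0$, $x_k=x'_k$ for $k\le n$, $x_n\notin\xi(H^1)$ if $n\ge1$, and $x_k=\xi^i(y_k)$, $x'_k=\xi^{1-i}(y_k)$ for $k>n$. Let $X_\xi^+=X_G^+/\!\sim_\xi$, with the quotient topology, quotient map $\pi_\xi$ and induced map $\sigma_\xi$. *The metric.* Let $G_\xi$ be $G$ with the edges $\xi^0(y)$ and $\xi^1(y)$ identified for each $y\in H^1$, and let $\tau_\xi:X_G^+\to X_{G_\xi}^+$ be the induced map. For $x\in X_G^+$ let $\kappa(x)\in\{0,1,\dots,\infty\}$ be the number of $n\ge1$ with $x_n\notin\xi(H^1)$,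 let $n(x)$ be the least such $n$ if $\kappa(x)>0$ and $n(x)=\infty$ otherwise, and let $\theta(x)=\exp\bigl(2\pi i\sum_{1\le j<n(x)}\varepsilon(x_j)2^{-j}\bigr)$, where $e\in\xi^{\varepsilon(e)}(H^1)$. Let $d_{\mathbb T}$ be arc length on the unit circle, normalized to total length $1$. For $\kappa(x)=\kappa(y)=0$ let $\lambda_0(x,y)=d_{\mathbb T}(\theta(x),\theta(y))$, and for $\kappa(x)=\kappa(y)=k$ with $1\le k<\infty$ let $$\lambda_k(x,y)=|2^{-n(x)}-2^{-n(y)}|+d_{\mathbb T}(\theta(x),\theta(y))+\delta\,2^{-2-n(x)}\lambda_{k-1}(\sigma^{n(x)}(x),\sigma^{n(y)}(y)),$$ where $\delta=1$ if $(n(x),\theta(x))=(n(y),\theta(y))$ and $\delta=0$ otherwise. The functions $d_k=d_{G_\xi}(\tau_\xi(\cdot),\tau_\xi(\cdot))+\lambda_k$ on $\kappa^{-1}\{k\}\times\kappa^{-1}\{k\}$, $k<\infty$, have a common continuous extension $d$ to $X_G^+\times X_G^+$; it is a pseudo-metric with $d(x,y)=0$ if and only if $x\sim_\xi y$, and $d_\xi$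 denotes the induced metric on $X_\xi^+$. *The two-sided factor.* Let $X_\xi=\{(x^n)_{n\ge0}: x^n\in X_\xi^+,\ x^n=\sigma_\xi(x^{n+1})\}$ be the inverse limit, with $\sigma_\xi(x)^n=\sigma_\xi(x^n)$ and $d_\xi(x,y)=\sup_{n\ge0}2^{-n}d_\xi(x^n,y^n)$, and let $\pi_\xi:X_G\to X_\xi$ be $\pi_\xi(x)^n=\pi_\xi(x_{1-n},x_{2-n},\dots)$. For $x,y\in X_\xi$ with $d_\xi(x,y)\le2^{-1}$, the bracket $[x,y]$ is defined, and equal to $z$, if $z$ is the unique element of $X_\xi$ with $z^0=x^0$ and $d_\xi(z^n,y^n)\le2^{-n-1}$ for all $n\ge0$. The stable set of $x$ in a system $(X,d,\varphi)$ is $X^s(x)=\{y: d(\varphi^n(x),\varphi^n(y))\to0 \text{ as } n\to+\infty\}$. **Theorem 4.3.** 1. $\pi_\xi:(X_G,d_G,\sigma)\to(X_\xi,d_\xi,\sigma_\xi)$ is a factor map: it is continuous (for the inverse limit topology and for $d_\xi$), surjective, and $\pi_\xi\circ\sigma=\sigma_\xi\circ\pi_\xi$. 2. If $x,y\in X_G$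 and $d_G(x,y)\le2^{-3}$, then $[x,y]$ and $[\pi_\xi(x),\pi_\xi(y)]$ are both defined and $\pi_\xi([x,y])=[\pi_\xi(x),\pi_\xi(y)]$. 3. For $x,y\in X_G$, $\pi_\xi(x)=\pi_\xi(y)$ if and only if exactly one of the following holds: (a) $x=y$; (b) there are $i\in\{0,1\}$ and $z\in X_H$ with $x_n=\xi^i(z_n)$ and $y_n=\xi^{1-i}(z_n)$ for all $n\in\mathbb Z$; (c) there are $m\in\mathbb Z$, $i\in\{0,1\}$ and an infinite path $(z_n)_{n>m}$ in $H$ such that $x_n=y_n$ for all $n<m$; $x_n=\xi^i(z_n)$ and $y_n=\xi^{1-i}(z_n)$ for all $n>m$; and either $x_m=y_m\notin\xi(H^1)$, or $x_m=\xi^{1-i}(z_m)$ and $y_m=\xi^i(z_m)$ for some edge $z_m$ of $H$ with $t(z_m)=i(z_{m+1})$. In particular, every fibre of $\pi_\xi$ has at most two points. 4. $\pi_\xi$ is $s$-bijective: for every $x\in X_G$, $\pi_\xi$ restricts to a bijection from $X_G^s(x)$ onto $X_\xi^s(\pi_\xi(x))$. -/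

import Mathlib

open Set Filter Topology

noncomputable section

namespace XiFactor

/-- A directed graph (multi-edges and loops allowed) with vertex set `V`, edge set `E`,
and initial and terminal vertex maps `i`, `t`. -/
structure EdgeGraph (V E : Type*) where
  i : E → V
  t : E → V

/-- The adjacency matrix: the entry `(v, w)` is the number of edges from `w` to `v`. -/
def EdgeGraph.adj {V E : Type*} (G : EdgeGraph V E) : Matrix V V ℕ :=
  fun v w => Nat.card {e : E // G.i e = w ∧ G.t e = v}

/-- Some positive power of the adjacency matrix has only positive entries. -/
def EdgeGraph.IsPrimitive {V E : Type*} [Fintype V] [DecidableEq V] (G : EdgeGraph V E) : Prop :=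
  ∃ k : ℕ, 0 < k ∧ ∀ v w : V, 0 < (G.adj ^ k) w v

/-- Graph embeddings: injective graph homomorphisms. -/
structure Embedding {W F V E : Type*} (H : EdgeGraph W F) (G : EdgeGraph V E) where
  onV : W → V
  onE : F → E
  map_i : ∀ e, G.i (onE e) = onV (H.i e)
  map_t : ∀ e, G.t (onE e) = onV (H.t e)
  injV : Function.Injective onV
  injE : Function.Injective onE

/-! ### Path spaces -/

/-- One-sided infinite paths `(x₁, x₂, …)`; the entry `x_{k+1}` is `x.val k`. -/
@[ext]
structure OneSided {V E : Type*} (G : EdgeGraph V E) where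
  val : ℕ → E
  isPath : ∀ n, G.t (val n) = G.i (val (n + 1))

/-- Bi-infinite paths, indexed by the integers. -/
@[ext]
structure TwoSided {V E : Type*} (G : EdgeGraph V E) where
  val : ℤ → E
  isPath : ∀ n, G.t (val n) = G.i (val (n + 1))

/-- The topology of the one-sided path space: subspace of the product of discrete spaces. -/
instance {V E : Type*} (G : EdgeGraph V E) : TopologicalSpace (OneSided G) :=
  TopologicalSpace.induced (fun x : OneSided G => x.val)
    (@Pi.topologicalSpace ℕ (fun _ => E) (fun _ => ⊥))

/-- The topology of the two-sided path space: subspace of the product of discrete spaces. -/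
instance {V E : Type*} (G : EdgeGraph V E) : TopologicalSpace (TwoSided G) :=
  TopologicalSpace.induced (fun x : TwoSided G => x.val)
    (@Pi.topologicalSpace ℤ (fun _ => E) (fun _ => ⊥))

/-- `d_G` on one-sided paths: `inf {2⁻ⁿ | x, y agree in the first n entries}`. -/
def dPos {V E : Type*} {G : EdgeGraph V E} (x y : OneSided G) : ℝ :=
  sInf {r : ℝ | ∃ n : ℕ, r = (2 : ℝ)⁻¹ ^ n ∧ ∀ k, k < n → x.val k = y.val k}

/-- `d_G` on bi-infinite paths: `inf {2⁻ⁿ | x_j = y_j for 1 - n ≤ j ≤ n}`. -/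
def dTwo {V E : Type*} {G : EdgeGraph V E} (x y : TwoSided G) : ℝ :=
  sInf {r : ℝ | ∃ n : ℕ, r = (2 : ℝ)⁻¹ ^ n ∧ ∀ j : ℤ, 1 - (n : ℤ) ≤ j → j ≤ n → x.val j = y.val j}

/-- The shift on one-sided paths. -/
def shiftPos {V E : Type*} {G : EdgeGraph V E} (x : OneSided G) : OneSided G :=
  ⟨fun n => x.val (n + 1), fun n => x.isPath (n + 1)⟩

/-- The shift on bi-infinite paths. -/
def shiftTwo {V E : Type*} {G : EdgeGraph V E} (x : TwoSided G) : TwoSided G :=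
  ⟨fun n => x.val (n + 1), fun n => x.isPath (n + 1)⟩

/-- The one-sided path `χ⁺(σ⁻ⁿ(x)) = (x_{1-n}, x_{2-n}, …)`. -/
def tailFrom {V E : Type*} {G : EdgeGraph V E} (x : TwoSided G) (n : ℕ) : OneSided G :=
  ⟨fun k => x.val (1 + (k : ℤ) - n), fun k => by
    have h := x.isPath (1 + (k : ℤ) - n)
    rwa [show 1 + (k : ℤ) - n + 1 = 1 + ((k + 1 : ℕ) : ℤ) - n by push_cast; ring] at h⟩

theorem dTwo_le_half {V E : Type*} {G : EdgeGraph V E} {x y : TwoSided G}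
    (h : dTwo x y ≤ 2⁻¹) : x.val 0 = y.val 0 ∧ x.val 1 = y.val 1 := by
  have h1 : dTwo x y < 1 := lt_of_le_of_lt h (by norm_num)
  obtain ⟨r, ⟨n, rfl, hn⟩, hr⟩ := exists_lt_of_csInf_lt
    (show Set.Nonempty {r : ℝ | ∃ n : ℕ, r = (2 : ℝ)⁻¹ ^ n ∧
      ∀ j : ℤ, 1 - (n : ℤ) ≤ j → j ≤ n → x.val j = y.val j} from
      ⟨1, 0, by simp, fun j h2 h3 => by push_cast at h2 h3; omega⟩) h1
  have hn0 : n ≠ 0 := by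
    rintro rfl
    simp at hr
  exact ⟨hn 0 (by omega) (by omega), hn 1 (by omega) (by omega)⟩

/-- The bracket `[x, y] = (…, y₋₁, y₀, x₁, x₂, …)` on bi-infinite paths,
defined for `d_G(x, y) ≤ 1/2`. -/
def bracketTwo {V E : Type*} {G : EdgeGraph V E} (x y : TwoSided G) (h : dTwo x y ≤ 2⁻¹) :
    TwoSided G :=
  ⟨fun n => if n ≤ 0 then y.val n else x.val n, fun n => by
    rcases lt_trichotomy n 0 with hn | hn | hn
    · rw [if_pos hn.le, if_pos (by omega)]
      exact y.isPath n
    · subst hn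
      simp only [le_refl, if_true]
      rw [if_neg (by omega), ← (dTwo_le_half h).1]
      exact x.isPath 0
    · rw [if_neg (by omega), if_neg (by omega)]
      exact x.isPath n⟩

/-! ### The combinatorial data `ξ = (ξ⁰, ξ¹)` -/

section Data

variable {W F V E : Type*} {H : EdgeGraph W F} {G : EdgeGraph V E} (ξ : Fin 2 → Embedding H G)

/-- `ξ(H¹) = ξ⁰(H¹) ∪ ξ¹(H¹)`. -/
def imageEdges : Set E := range (ξ 0).onE ∪ range (ξ 1).onE

/-- `G` is primitive and `ξ` satisfies (H0), (H1), (H2). -/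
structure StandingHypotheses [Fintype V] [DecidableEq V] : Prop where
  primitive : G.IsPrimitive
  h0 : (ξ 0).onV = (ξ 1).onV
  h1 : range (ξ 0).onE ∩ range (ξ 1).onE = ∅
  h2 : ∀ y : F, ∃ x : E, G.t x = G.t ((ξ 0).onE y) ∧ G.i x = G.i ((ξ 0).onE y) ∧
    x ∉ imageEdges ξ

open Classical in
/-- `ε(e) ∈ {0, 1}` with `e ∈ ξ^{ε(e)}(H¹)`, for edges `e ∈ ξ(H¹)`. -/
def eps (e : E) : ℝ := if e ∈ range (ξ 1).onE then 1 else 0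

/-- The endpoints are unchanged when `ξ⁰(y)` and `ξ¹(y)` are identified. -/
theorem endpoints_eq (h0 : (ξ 0).onV = (ξ 1).onV) (y : F) :
    G.i ((ξ 0).onE y) = G.i ((ξ 1).onE y) ∧ G.t ((ξ 0).onE y) = G.t ((ξ 1).onE y) := by
  simp [(ξ 0).map_i, (ξ 1).map_i, (ξ 0).map_t, (ξ 1).map_t, h0]

/-- The edges of `G_ξ`: edges of `G` with `ξ⁰(y)` and `ξ¹(y)` identified, for each `y`. -/
def QuotEdge := Quot fun e f : E => ∃ y : F, e = (ξ 0).onE y ∧ f = (ξ 1).onE y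

/-- The graph `G_ξ`. -/
def quotGraph (h0 : (ξ 0).onV = (ξ 1).onV) : EdgeGraph V (QuotEdge ξ) where
  i := Quot.lift G.i (by rintro _ _ ⟨y, rfl, rfl⟩; exact (endpoints_eq ξ h0 y).1)
  t := Quot.lift G.t (by rintro _ _ ⟨y, rfl, rfl⟩; exact (endpoints_eq ξ h0 y).2)

/-- `τ_ξ` on one-sided paths. -/
def tau (h0 : (ξ 0).onV = (ξ 1).onV) (x : OneSided G) : OneSided (quotGraph ξ h0) :=
  ⟨fun n => Quot.mk _ (x.val n), fun n => x.isPath n⟩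

/-- `κ(x)`: the number of entries of `x` outside `ξ(H¹)`. -/
def kappa (x : OneSided G) : ℕ∞ := {n : ℕ | x.val n ∉ imageEdges ξ}.encard

/-- `n(x)`: the least positive `n` such that the entry `x_n` is outside `ξ(H¹)`
(only used when `κ(x) > 0`). -/
def firstOut (x : OneSided G) : ℕ := sInf {n : ℕ | x.val n ∉ imageEdges ξ} + 1

open Classical in
/-- The point `θ(x)` of the unit circle. -/
def theta (x : OneSided G) : ℂ :=
  if kappa ξ x = 0 then
    Complex.exp (2 * Real.pi * Complex.I *
      ((∑' k : ℕ, eps ξ (x.val k) * (2 : ℝ)⁻¹ ^ (k + 1) : ℝ) : ℂ))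
  else
    Complex.exp (2 * Real.pi * Complex.I *
      ((∑ k ∈ Finset.range (firstOut ξ x - 1), eps ξ (x.val k) * (2 : ℝ)⁻¹ ^ (k + 1) : ℝ) : ℂ))

/-- The distance on the unit circle, of total length `1`. -/
def dCircle (a b : ℂ) : ℝ :=
  sInf {r : ℝ | ∃ s : ℝ, r = |s| ∧ Complex.exp (2 * Real.pi * Complex.I * (s : ℂ)) * a = b}

open Classical in
/-- The functions `λ_k`, meaningful on pairs with `κ(x) = κ(y) = k`. -/
def lam : ℕ → OneSided G → OneSided G → ℝ
  | 0, x, y => dCircle (theta ξ x) (theta ξ y)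
  | k + 1, x, y =>
      |(2 : ℝ)⁻¹ ^ firstOut ξ x - (2 : ℝ)⁻¹ ^ firstOut ξ y| + dCircle (theta ξ x) (theta ξ y) +
        if firstOut ξ x = firstOut ξ y ∧ theta ξ x = theta ξ y then
          (2 : ℝ)⁻¹ ^ (2 + firstOut ξ x) *
            lam k (shiftPos^[firstOut ξ x] x) (shiftPos^[firstOut ξ y] y)
        else 0

/-- The pseudo-metrics `d_k(x, y) = d_{G_ξ}(τ_ξ(x), τ_ξ(y)) + λ_k(x, y)` on `κ⁻¹{k}`. -/
def dLevel (h0 : (ξ 0).onV = (ξ 1).onV) (k : ℕ) (x y : OneSided G) : ℝ :=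
  dPos (tau ξ h0 x) (tau ξ h0 y) + lam ξ k x y

/-- The pseudo-metric `d` on one-sided paths: the common extension by continuity of the `d_k`,
`k = 0, 1, 2, …`, from the union of the sets `κ⁻¹{k} × κ⁻¹{k}`. -/
def dExt (h0 : (ξ 0).onV = (ξ 1).onV) (x y : OneSided G) : ℝ :=
  extendFrom {p : OneSided G × OneSided G | kappa ξ p.1 = kappa ξ p.2 ∧ kappa ξ p.1 ≠ ⊤}
    (fun p => dLevel ξ h0 (kappa ξ p.1).toNat p.1 p.2) (x, y)

/-! ### The one-sided factor -/

/-- `x = (…, ξ^{1-i}(y_n), ξ^i(y_{n+1}), …)`, `x' = (…, ξ^i(y_n), ξ^{1-i}(y_{n+1}), …)`. -/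
def Flip₁ (x x' : OneSided G) : Prop :=
  ∃ (n : ℕ) (i : Fin 2) (y : ℕ → F),
    (∀ k, k < n → x.val k = x'.val k) ∧
    x.val n = (ξ (1 - i)).onE (y n) ∧ x'.val n = (ξ i).onE (y n) ∧
    ∀ k, n < k → x.val k = (ξ i).onE (y k) ∧ x'.val k = (ξ (1 - i)).onE (y k)

/-- `x = (x₁, …, x_n, ξ^i(y_{n+1}), …)`, `x' = (x₁, …, x_n, ξ^{1-i}(y_{n+1}), …)` with
`x_n ∉ ξ(H¹)`; this last condition is void if `n = 0`. -/
def Flip₂ (x x' : OneSided G) : Prop :=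
  ∃ (n : ℕ) (i : Fin 2) (y : ℕ → F),
    (∀ k, k < n → x.val k = x'.val k) ∧
    (∀ k, k + 1 = n → x.val k ∉ imageEdges ξ) ∧
    ∀ k, n ≤ k → x.val k = (ξ i).onE (y k) ∧ x'.val k = (ξ (1 - i)).onE (y k)

/-- The relation `∼_ξ`. -/
def Rel (x x' : OneSided G) : Prop := x = x' ∨ Flip₁ ξ x x' ∨ Flip₂ ξ x x'

theorem Rel.shift {x x' : OneSided G} (h : Rel ξ x x') : Rel ξ (shiftPos x) (shiftPos x') := by
  rcases h with rfl | ⟨n, i, y, h1, h2, h3, h4⟩ | ⟨n, i, y, h1, h2, h3⟩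
  · exact Or.inl rfl
  · cases n with
    | zero =>
      exact Or.inr (Or.inr ⟨0, i, fun k => y (k + 1), fun k hk => absurd hk (by omega),
        fun k hk => absurd hk (by omega), fun k _ => h4 (k + 1) (by omega)⟩)
    | succ n =>
      exact Or.inr (Or.inl ⟨n, i, fun k => y (k + 1), fun k hk => h1 (k + 1) (by omega), h2, h3,
        fun k hk => h4 (k + 1) (by omega)⟩)
  · cases n with
    | zero =>
      exact Or.inr (Or.inr ⟨0, i, fun k => y (k + 1), fun k hk => absurd hk (by omega),
        fun k hk => absurd hk (by omega), fun k _ => h3 (k + 1) (by omega)⟩)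
    | succ n =>
      exact Or.inr (Or.inr ⟨n, i, fun k => y (k + 1), fun k hk => h1 (k + 1) (by omega),
        fun k hk => h2 (k + 1) (by omega), fun k hk => h3 (k + 1) (by omega)⟩)

/-- `X_ξ⁺`, the quotient of the one-sided path space by `∼_ξ`, with the quotient topology. -/
abbrev QuotPos := Quot (Rel ξ)

/-- The quotient map `π_ξ` on one-sided paths. -/
def piPos (x : OneSided G) : QuotPos ξ := Quot.mk (Rel ξ) x

/-- `σ_ξ` on `X_ξ⁺`. -/
def shiftQuot : QuotPos ξ → QuotPos ξ := Quot.map shiftPos fun _ _ h => Rel.shift ξ h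

/-- The metric `d_ξ` on `X_ξ⁺` induced by the pseudo-metric `d`, evaluated on representatives. -/
def dQuot (h0 : (ξ 0).onV = (ξ 1).onV) (p q : QuotPos ξ) : ℝ :=
  dExt ξ h0 (Quot.out p) (Quot.out q)

/-! ### The inverse limit -/

/-- `X_ξ`, the inverse limit of `X_ξ⁺ ← X_ξ⁺ ← ⋯` along `σ_ξ`. -/
@[ext]
structure InvLim where
  val : ℕ → QuotPos ξ
  compat : ∀ n, val n = shiftQuot ξ (val (n + 1))

/-- The inverse limit topology: subspace of the product. -/
instance : TopologicalSpace (InvLim ξ) :=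
  TopologicalSpace.induced (fun x : InvLim ξ => x.val) inferInstance

/-- `σ_ξ` on `X_ξ`. -/
def shiftLim (x : InvLim ξ) : InvLim ξ :=
  ⟨fun n => shiftQuot ξ (x.val n), fun n => congrArg (shiftQuot ξ) (x.compat n)⟩

/-- `d_ξ` on `X_ξ`: `sup {2⁻ⁿ d_ξ(xⁿ, yⁿ) | n ≥ 0}`. -/
def dLim (h0 : (ξ 0).onV = (ξ 1).onV) (x y : InvLim ξ) : ℝ :=
  ⨆ n : ℕ, (2 : ℝ)⁻¹ ^ n * dQuot ξ h0 (x.val n) (y.val n)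

/-- `π_ξ : X_G → X_ξ`, sending `x` to the sequence `π_ξ(χ⁺(σ⁻ⁿ(x)))`, `n ≥ 0`. -/
def piTwo (x : TwoSided G) : InvLim ξ :=
  ⟨fun n => piPos ξ (tailFrom x n), fun n => by
    have h : tailFrom x n = shiftPos (tailFrom x (n + 1)) := by
      ext k
      simp only [tailFrom, shiftPos]
      congr 1
      push_cast
      ring
    exact congrArg (Quot.mk (Rel ξ)) h⟩

/-- `z` is a value of the bracket `[x, y]` on `X_ξ`: `d_ξ(x, y) ≤ 1/2`, `z⁰ = x⁰` and
`d_ξ(zⁿ, yⁿ) ≤ 2⁻ⁿ⁻¹` for all `n` (and `σ_ξ(zⁿ⁺¹) = zⁿ`, since `z ∈ X_ξ`). -/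
def IsBracket (h0 : (ξ 0).onV = (ξ 1).onV) (x y z : InvLim ξ) : Prop :=
  dLim ξ h0 x y ≤ 2⁻¹ ∧ z.val 0 = x.val 0 ∧
    ∀ n : ℕ, dQuot ξ h0 (z.val n) (y.val n) ≤ (2 : ℝ)⁻¹ ^ (n + 1)

/-- `x = ξ^i(z)` and `y = ξ^{1-i}(z)` for a bi-infinite path `z` in `H`. -/
def FullFlip (x y : TwoSided G) : Prop :=
  ∃ (i : Fin 2) (z : TwoSided H), ∀ n : ℤ,
    x.val n = (ξ i).onE (z.val n) ∧ y.val n = (ξ (1 - i)).onE (z.val n)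

/-- There are an integer `m`, `i ∈ {0, 1}` and a path `z_{m+1}, z_{m+2}, …` in `H` with
`x_n = y_n` for `n < m`; with `x_n = ξ^i(z_n)`, `y_n = ξ^{1-i}(z_n)` for `n > m`; and either
`x_m = y_m ∉ ξ(H¹)`, or `x_m = ξ^{1-i}(e)`, `y_m = ξ^i(e)` for an edge `e = z_m` of `H` such that
`z_m, z_{m+1}, …` is still a path. The entry `z_{m+1+k}` is `z.val k`. -/
def TailFlip (x y : TwoSided G) : Prop :=
  ∃ (m : ℤ) (i : Fin 2) (z : OneSided H),
    (∀ n, n < m → x.val n = y.val n) ∧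
    ((x.val m = y.val m ∧ x.val m ∉ imageEdges ξ) ∨
      ∃ e : F, H.t e = H.i (z.val 0) ∧ x.val m = (ξ (1 - i)).onE e ∧ y.val m = (ξ i).onE e) ∧
    ∀ k : ℕ, x.val (m + 1 + k) = (ξ i).onE (z.val k) ∧ y.val (m + 1 + k) = (ξ (1 - i)).onE (z.val k)

end Data

/-- Exactly one of three propositions holds. -/
def ExactlyOne (a b c : Prop) : Prop :=
  (a ∧ ¬b ∧ ¬c) ∨ (¬a ∧ b ∧ ¬c) ∨ (¬a ∧ ¬b ∧ c)

/-- The global stable set `{y | d(φⁿ(x), φⁿ(y)) → 0 as n → ∞}`. -/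
def stableSet {X : Type*} (d : X → X → ℝ) (φ : X → X) (x : X) : Set X :=
  {y | Tendsto (fun n : ℕ => d (φ^[n] x) (φ^[n] y)) atTop (𝓝 0)}

end XiFactor

end

/-! Each one-sided path carries a code: for every `n`, the class of `x_n` in `G_ξ` together with the
angle of `σⁿ(x)` in `ℝ/ℤ`. Inside `ξ(H¹)` the entries contribute binary digits, so the shift doubles
the angle; at an entry outside `ξ(H¹)` the angle is `0`. The relation `∼_ξ` is equality of codes
(`rel_iff_sameCode`): `Flip₁` is the ambiguity `0.1000… = 0.0111…` of binary expansions, and `Flip₂`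
from a fresh start is `0.000… = 0.111…` modulo `1`.

The metric has a closed form. The recursions for the `λ_k` are instances of a single convergent
series `lamInf`, which is continuous, and pairs with equal finite `κ` are dense by primitivity, (H2)
and `X_H ≠ ∅`. Hence `d` is `d_{G_ξ} + lamInf` (`dExt_eq`). Only three consequences are needed:
paths that agree in `N` entries are within `3·2⁻ᴺ`; distance below `1` determines the first class;
and `d` bounds the distance of angles.

The dynamics is that of the doubling map. Forward, angles that stay within `1/4` have their distance
doubled at each step inside `ξ(H¹)`, hence coincide (`SameCode.of_dist_le`). Backward, `2a` and a
location of `a` to within less than half a circle determine `a` (`SameCode.of_shift_of_dist_lt`),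
which makes the bracket unique.

Distinct points in one fibre are eventually opposite lifts of the same edges of `H`. There are only
two lifts, so a fibre has at most two points, and these are never asymptotic: this is injectivity on
stable sets. Surjectivity of `π_ξ` follows from compactness, the one-sided fibres being finite. For
surjectivity on stable sets, expansiveness makes far tails `∼_ξ`-related; if they are opposite,
passing to the other point of the fibre makes them equal (`exists_piTwo_eq_of_flipped`). -/

namespace XiFactor

/-! ### One-sided paths: the metric `d_G` and cylinder neighbourhoods. -/

section PathMetric

variable {V E : Type*} {G : EdgeGraph V E}

/-- Two one-sided paths agree in their first `N` entries. -/
def Agree (N : ℕ) (x y : OneSided G) : Prop := ∀ k, k < N → x.val k = y.val k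

theorem Agree.symm {N : ℕ} {x y : OneSided G} (h : Agree N x y) : Agree N y x :=
  fun k hk => (h k hk).symm

theorem Agree.shift {N : ℕ} {x y : OneSided G} (h : Agree (N + 1) x y) :
    Agree N (shiftPos x) (shiftPos y) :=
  fun k hk => h (k + 1) (by omega)

theorem iterate_shiftPos_val (n : ℕ) (x : OneSided G) (k : ℕ) :
    (shiftPos^[n] x).val k = x.val (k + n) := by
  induction n generalizing x with
  | zero => rfl
  | succ n ih =>
    rw [Function.iterate_succ_apply, ih]
    simp only [shiftPos]
    congr 1

theorem dPos_bddBelow (x y : OneSided G) :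
    BddBelow {r : ℝ | ∃ n : ℕ, r = (2 : ℝ)⁻¹ ^ n ∧ ∀ k, k < n → x.val k = y.val k} :=
  ⟨0, by rintro _ ⟨n, rfl, -⟩; positivity⟩

theorem dPos_nonempty (x y : OneSided G) :
    Set.Nonempty {r : ℝ | ∃ n : ℕ, r = (2 : ℝ)⁻¹ ^ n ∧ ∀ k, k < n → x.val k = y.val k} :=
  ⟨1, 0, by simp, fun k hk => absurd hk (by omega)⟩

theorem dPos_nonneg (x y : OneSided G) : 0 ≤ dPos x y :=
  le_csInf (dPos_nonempty x y) (by rintro _ ⟨n, rfl, -⟩; positivity)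

theorem dPos_le_of_agree {N : ℕ} {x y : OneSided G} (h : Agree N x y) :
    dPos x y ≤ (2 : ℝ)⁻¹ ^ N :=
  csInf_le (dPos_bddBelow x y) ⟨N, rfl, h⟩

theorem dPos_le_one (x y : OneSided G) : dPos x y ≤ 1 := by
  simpa using dPos_le_of_agree (N := 0) (x := x) (y := y) fun k hk => absurd hk (by omega)

theorem agree_of_dPos_lt {N : ℕ} {x y : OneSided G} (h : dPos x y < (2 : ℝ)⁻¹ ^ N) :
    Agree (N + 1) x y := by
  obtain ⟨r, ⟨n, rfl, hn⟩, hr⟩ := exists_lt_of_csInf_lt (dPos_nonempty x y) h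
  have : N < n := (pow_lt_pow_iff_right_of_lt_one₀ (by norm_num) (by norm_num)).1 hr
  exact fun k hk => hn k (by omega)

theorem dPos_comm (x y : OneSided G) : dPos x y = dPos y x := by
  unfold dPos
  congr 1
  ext r
  simp only [eq_comm]

theorem dPos_triangle (x y z : OneSided G) : dPos x z ≤ dPos x y + dPos y z := by
  have key : ∀ r ∈ {r : ℝ | ∃ n : ℕ, r = (2 : ℝ)⁻¹ ^ n ∧ ∀ k, k < n → x.val k = y.val k},
      dPos x z - r ≤ dPos y z := by
    rintro _ ⟨n, rfl, hn⟩
    refine le_csInf (dPos_nonempty y z) ?_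
    rintro _ ⟨m, rfl, hm⟩
    have h := dPos_le_of_agree (N := min n m) (x := x) (y := z)
      fun k hk => (hn k (by omega)).trans (hm k (by omega))
    have h1 : (0 : ℝ) < 2⁻¹ ^ n := by positivity
    have h2 : (0 : ℝ) < 2⁻¹ ^ m := by positivity
    rcases min_choice n m with h3 | h3 <;> rw [h3] at h <;> linarith
  have : dPos x z - dPos y z ≤ dPos x y :=
    le_csInf (dPos_nonempty x y) fun r hr => by linarith [key r hr]
  linarith

/-- A basic open set of the product constrains finitely many coordinates, hence contains a cylinder.
Continuity thereby reduces to estimates in the length of agreement. -/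
theorem mem_nhds_oneSided {x : OneSided G} {s : Set (OneSided G)} :
    s ∈ 𝓝 x ↔ ∃ N, ∀ y, Agree N x y → y ∈ s := by
  let _ : TopologicalSpace E := ⊥
  have : DiscreteTopology E := ⟨rfl⟩
  have hn : 𝓝 x = Filter.comap (fun x : OneSided G => x.val) (𝓝 x.val) :=
    nhds_induced _ _
  rw [hn, nhds_pi]
  constructor
  · rintro ⟨t, ht, hts⟩
    obtain ⟨I, hI, u, hu, hut⟩ := Filter.mem_pi.1 ht
    obtain ⟨N, hN⟩ := hI.bddAbove
    refine ⟨N + 1, fun y hy => hts (hut fun i hi => ?_)⟩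
    have h := hN hi
    have := mem_of_mem_nhds (hu i)
    rwa [hy i (by omega)] at this
  · rintro ⟨N, hN⟩
    refine ⟨(Set.Iio N).pi fun i => {x.val i}, Filter.pi_mem_pi (Set.finite_Iio N)
      fun i _ => by simp, fun y hy => hN y fun k hk => (hy k hk).symm⟩

end PathMetric

theorem fin_two_eq_zero_or_one (i : Fin 2) : i = 0 ∨ i = 1 := by
  revert i; decide

theorem fin_two_one_sub_ne (i : Fin 2) : 1 - i ≠ i := by
  revert i; decide

theorem fin_two_one_sub_one_sub (i : Fin 2) : 1 - (1 - i) = i := by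
  revert i; decide

theorem fin_two_eq_one_sub_of_ne {i j : Fin 2} : j ≠ i → j = 1 - i := by
  revert i j; decide

/-! ### Arc length on the circle as the metric of `ℝ/ℤ`, and the doubling map. -/

section Circle

theorem exp_two_pi_I_eq_iff (s t : ℝ) :
    Complex.exp (2 * Real.pi * Complex.I * (s : ℂ)) =
      Complex.exp (2 * Real.pi * Complex.I * (t : ℂ)) ↔ ∃ n : ℤ, s = t + n := by
  rw [Complex.exp_eq_exp_iff_exists_int]
  refine exists_congr fun n => ?_
  have h : (2 * Real.pi * Complex.I : ℂ) ≠ 0 := Complex.two_pi_I_ne_zero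
  rw [show (2 * Real.pi * Complex.I * (t : ℂ) + n * (2 * Real.pi * Complex.I) : ℂ) =
    2 * Real.pi * Complex.I * ((t + n : ℝ) : ℂ) by push_cast; ring]
  rw [mul_right_inj' h, Complex.ofReal_inj]

theorem coe_unitAddCircle_eq_iff (s t : ℝ) :
    (s : UnitAddCircle) = (t : UnitAddCircle) ↔ ∃ n : ℤ, s = t + n := by
  rw [← sub_eq_zero, ← AddCircle.coe_sub, AddCircle.coe_eq_zero_iff]
  refine exists_congr fun n => ?_
  rw [zsmul_eq_mul, mul_one]
  constructor <;> intro h <;> linarith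

/-- The admissible rotations are the real lifts of the difference `t - s`, and the infimum is
attained by subtracting the nearest integer. -/
theorem dCircle_exp (s t : ℝ) :
    dCircle (Complex.exp (2 * Real.pi * Complex.I * (s : ℂ)))
      (Complex.exp (2 * Real.pi * Complex.I * (t : ℂ))) =
    dist (s : UnitAddCircle) (t : UnitAddCircle) := by
  have hset : ∀ u : ℝ, Complex.exp (2 * Real.pi * Complex.I * (u : ℂ)) *
      Complex.exp (2 * Real.pi * Complex.I * (s : ℂ)) =
      Complex.exp (2 * Real.pi * Complex.I * (t : ℂ)) ↔ ∃ n : ℤ, u + s = t + n := by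
    intro u
    rw [← Complex.exp_add, ← mul_add, ← Complex.ofReal_add, exp_two_pi_I_eq_iff]
  rw [dist_comm, dist_eq_norm, ← AddCircle.coe_sub, UnitAddCircle.norm_eq]
  unfold dCircle
  simp only [hset]
  apply le_antisymm
  · refine csInf_le ⟨0, ?_⟩ ⟨_, rfl, -round (t - s), by push_cast; ring⟩
    rintro _ ⟨u, rfl, -⟩
    exact abs_nonneg u
  · refine le_csInf ⟨_, _, rfl, -round (t - s), show t - s - round (t - s) + s = _ by
      push_cast; ring⟩ ?_
    rintro _ ⟨u, rfl, n, hn⟩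
    have h := round_le (t - s) (-n)
    rwa [show t - s - ((-n : ℤ) : ℝ) = u by push_cast; linarith] at h

theorem unitAddCircle_dist_le_half (a b : UnitAddCircle) : dist a b ≤ 1 / 2 := by
  rw [dist_eq_norm]
  simpa using AddCircle.norm_le_half_period (1 : ℝ) (x := a - b) one_ne_zero

theorem unitAddCircle_dist_coe_le (s t : ℝ) :
    dist (s : UnitAddCircle) (t : UnitAddCircle) ≤ |s - t| := by
  rw [dist_eq_norm, ← AddCircle.coe_sub, UnitAddCircle.norm_eq]
  simpa using round_le (s - t) 0

theorem exists_coe_eq_abs_eq_norm (u : UnitAddCircle) :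
    ∃ t : ℝ, (t : UnitAddCircle) = u ∧ |t| = ‖u‖ := by
  induction u using QuotientAddGroup.induction_on with
  | H x =>
    refine ⟨x - round x, (coe_unitAddCircle_eq_iff _ _).2 ⟨-round x, by push_cast; ring⟩, ?_⟩
    exact UnitAddCircle.norm_eq.symm

/-- Doubling is injective at scales below half of the circle. -/
theorem eq_of_two_nsmul_eq {a b : UnitAddCircle} (h : 2 • a = 2 • b) (hd : dist a b < 1 / 2) :
    a = b := by
  -- For a shortest lift `t` of the difference, `2t` is an integer of absolute value below `1`.
  obtain ⟨t, ht, hn⟩ := exists_coe_eq_abs_eq_norm (a - b)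
  rw [dist_eq_norm, ← hn] at hd
  have h2 : ((2 * t : ℝ) : UnitAddCircle) = ((0 : ℝ) : UnitAddCircle) := by
    rw [show (2 * t : ℝ) = 2 • t by simp, AddCircle.coe_nsmul, ht, smul_sub, h, sub_self]
    rfl
  obtain ⟨n, hn'⟩ := (coe_unitAddCircle_eq_iff _ _).1 h2
  have hlt := abs_lt.1 hd
  have h3 : n < 1 := by exact_mod_cast (show (n : ℝ) < 1 by linarith)
  have h4 : -1 < n := by exact_mod_cast (show (-1 : ℝ) < n by linarith)
  obtain rfl : n = 0 := by omega
  obtain rfl : t = 0 := by simpa using hn'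
  exact sub_eq_zero.1 (ht.symm.trans (AddCircle.coe_zero _))

/-- A shortest lift `t` of the difference has `|2t| ≤ 1/2`, so `2t` is still a shortest lift. -/
theorem dist_two_nsmul {a b : UnitAddCircle} (hd : dist a b ≤ 1 / 4) :
    dist (2 • a) (2 • b) = 2 * dist a b := by
  obtain ⟨t, ht, hn⟩ := exists_coe_eq_abs_eq_norm (a - b)
  rw [dist_eq_norm, ← hn] at hd
  rw [dist_eq_norm, dist_eq_norm, ← smul_sub, ← hn, ← ht, ← AddCircle.coe_nsmul,
    (AddCircle.norm_coe_eq_abs_iff (1 : ℝ) one_ne_zero).2]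
  · simp [abs_mul]
  · simp only [nsmul_eq_mul, Nat.cast_ofNat, abs_mul, Nat.abs_ofNat, abs_one]
    linarith

end Circle

/-! ### The code of a one-sided path: edge classes, exit times and angles. -/

section Code

variable {W F V E : Type*} {H : EdgeGraph W F} {G : EdgeGraph V E} (ξ : Fin 2 → Embedding H G)

theorem mem_imageEdges {e : E} : e ∈ imageEdges ξ ↔ ∃ i y, e = (ξ i).onE y := by
  simp only [imageEdges, mem_union, mem_range, Fin.exists_fin_two, eq_comm]

theorem onE_inj (h1 : range (ξ 0).onE ∩ range (ξ 1).onE = ∅) {i j : Fin 2} {y y' : F}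
    (h : (ξ i).onE y = (ξ j).onE y') : i = j ∧ y = y' := by
  have hd : ∀ a b, (ξ 0).onE a ≠ (ξ 1).onE b := fun a b hab =>
    (h1 ▸ (⟨⟨a, rfl⟩, ⟨b, hab.symm⟩⟩ : (ξ 0).onE a ∈ range (ξ 0).onE ∩ range (ξ 1).onE) :
      (ξ 0).onE a ∈ (∅ : Set E))
  rcases fin_two_eq_zero_or_one i with rfl | rfl <;>
    rcases fin_two_eq_zero_or_one j with rfl | rfl
  · exact ⟨rfl, (ξ 0).injE h⟩
  · exact absurd h (hd _ _)
  · exact absurd h.symm (hd _ _)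
  · exact ⟨rfl, (ξ 1).injE h⟩

theorem eps_onE (h1 : range (ξ 0).onE ∩ range (ξ 1).onE = ∅) (i : Fin 2) (y : F) :
    eps ξ ((ξ i).onE y) = (i : ℕ) := by
  unfold eps
  split_ifs with h
  · obtain ⟨z, hz⟩ := h
    obtain ⟨rfl, -⟩ := onE_inj ξ h1 hz
    simp
  · rcases fin_two_eq_zero_or_one i with rfl | rfl
    · simp
    · exact absurd ⟨y, rfl⟩ h

theorem eps_eq_zero_or_one (e : E) : eps ξ e = 0 ∨ eps ξ e = 1 := by
  unfold eps
  split_ifs <;> simp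

theorem eps_nonneg (e : E) : 0 ≤ eps ξ e := by
  rcases eps_eq_zero_or_one ξ e with h | h <;> norm_num [h]

theorem eps_le_one (e : E) : eps ξ e ≤ 1 := by
  rcases eps_eq_zero_or_one ξ e with h | h <;> norm_num [h]

/-- The class of an edge of `G` as an edge of `G_ξ`. -/
def edgeClass (e : E) : QuotEdge ξ := Quot.mk _ e

theorem edgeClass_onE (i j : Fin 2) (y : F) :
    edgeClass ξ ((ξ i).onE y) = edgeClass ξ ((ξ j).onE y) := by
  have h : edgeClass ξ ((ξ 0).onE y) = edgeClass ξ ((ξ 1).onE y) := Quot.sound ⟨y, rfl, rfl⟩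
  rcases fin_two_eq_zero_or_one i with rfl | rfl <;>
    rcases fin_two_eq_zero_or_one j with rfl | rfl <;> simp [h]

/-- By (H1) and injectivity the identified pairs are disjoint, so the generated equivalence relation
never chains two of them. -/
theorem edgeClass_eq_iff (h1 : range (ξ 0).onE ∩ range (ξ 1).onE = ∅) {e f : E} :
    edgeClass ξ e = edgeClass ξ f ↔
      e = f ∨ ∃ i y, e = (ξ i).onE y ∧ f = (ξ (1 - i)).onE y := by
  constructor
  · intro h
    induction Quot.eqvGen_exact h with
    | rel e f hef =>
      obtain ⟨y, rfl, rfl⟩ := hef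
      exact Or.inr ⟨0, y, rfl, rfl⟩
    | refl e => exact Or.inl rfl
    | symm e f hef ih =>
      rcases ih h.symm with rfl | ⟨i, y, rfl, rfl⟩
      · exact Or.inl rfl
      · exact Or.inr ⟨1 - i, y, rfl, by rw [fin_two_one_sub_one_sub]⟩
    | trans e f g hef hfg ih1 ih2 =>
      rcases ih1 (Quot.eqvGen_sound hef) with rfl | ⟨i, y, rfl, rfl⟩
      · exact ih2 (Quot.eqvGen_sound hfg)
      · rcases ih2 (Quot.eqvGen_sound hfg) with rfl | ⟨j, z, hz, rfl⟩
        · exact Or.inr ⟨i, y, rfl, rfl⟩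
        · obtain ⟨rfl, rfl⟩ := onE_inj ξ h1 hz
          exact Or.inl (by rw [fin_two_one_sub_one_sub])
  · rintro (rfl | ⟨i, y, rfl, rfl⟩)
    · rfl
    · exact edgeClass_onE ξ _ _ _

theorem mem_imageEdges_iff_of_edgeClass_eq (h1 : range (ξ 0).onE ∩ range (ξ 1).onE = ∅) {e f : E}
    (h : edgeClass ξ e = edgeClass ξ f) : e ∈ imageEdges ξ ↔ f ∈ imageEdges ξ := by
  rcases (edgeClass_eq_iff ξ h1).1 h with rfl | ⟨i, y, rfl, rfl⟩
  · rfl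
  · exact iff_of_true ((mem_imageEdges ξ).2 ⟨_, _, rfl⟩) ((mem_imageEdges ξ).2 ⟨_, _, rfl⟩)

open Classical in
theorem kappa_eq_shift (x : OneSided G) :
    kappa ξ x = kappa ξ (shiftPos x) + if x.val 0 ∈ imageEdges ξ then 0 else 1 := by
  have him : (Nat.succ '' {n : ℕ | (shiftPos x).val n ∉ imageEdges ξ}).encard =
      kappa ξ (shiftPos x) := Nat.succ_injective.encard_image _
  rw [← him]
  unfold kappa
  split_ifs with h
  · rw [add_zero]
    congr 1
    ext n
    cases n with
    | zero => simp [h]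
    | succ n => simp [shiftPos]
  · rw [← Set.encard_insert_of_notMem (a := 0) (by simp)]
    congr 1
    ext n
    cases n with
    | zero => simp [h]
    | succ n => simp [shiftPos]

theorem kappa_eq_zero_iff {x : OneSided G} : kappa ξ x = 0 ↔ ∀ n, x.val n ∈ imageEdges ξ := by
  unfold kappa
  rw [Set.encard_eq_zero, Set.eq_empty_iff_forall_notMem]
  simp

theorem kappa_shift_of_mem {x : OneSided G} (h : x.val 0 ∈ imageEdges ξ) :
    kappa ξ (shiftPos x) = kappa ξ x := by
  classical
  rw [kappa_eq_shift ξ x, if_pos h, add_zero]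

theorem kappa_ne_zero_of_notMem {x : OneSided G} (h : x.val 0 ∉ imageEdges ξ) :
    kappa ξ x ≠ 0 :=
  fun h0 => h ((kappa_eq_zero_iff ξ).1 h0 0)

theorem firstOut_of_notMem {x : OneSided G} (h : x.val 0 ∉ imageEdges ξ) : firstOut ξ x = 1 := by
  unfold firstOut
  rw [Nat.sInf_eq_zero.2 (Or.inl h)]

theorem firstOut_of_mem {x : OneSided G} (h : x.val 0 ∈ imageEdges ξ) (hk : kappa ξ x ≠ 0) :
    firstOut ξ x = firstOut ξ (shiftPos x) + 1 := by
  unfold firstOut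
  have hne : {n : ℕ | x.val n ∉ imageEdges ξ}.Nonempty := by
    rw [Set.nonempty_iff_ne_empty]
    intro h0
    exact hk (by rw [kappa, h0, Set.encard_empty])
  have h1 : 1 ≤ sInf {n : ℕ | x.val n ∉ imageEdges ξ} := by
    have := Nat.sInf_mem hne
    by_contra hlt
    rw [show sInf {n : ℕ | x.val n ∉ imageEdges ξ} = 0 by omega] at this
    exact this h
  exact congrArg (· + 1) (Nat.sInf_add (p := fun n => x.val n ∉ imageEdges ξ) h1).symm

/-- The path that remains after the first entry outside `ξ(H¹)`. -/
noncomputable def afterOut (x : OneSided G) : OneSided G := shiftPos^[firstOut ξ x] x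

theorem afterOut_of_notMem {x : OneSided G} (h : x.val 0 ∉ imageEdges ξ) :
    afterOut ξ x = shiftPos x := by
  rw [afterOut, firstOut_of_notMem ξ h, Function.iterate_one]

theorem afterOut_of_mem {x : OneSided G} (h : x.val 0 ∈ imageEdges ξ) (hk : kappa ξ x ≠ 0) :
    afterOut ξ x = afterOut ξ (shiftPos x) := by
  rw [afterOut, firstOut_of_mem ξ h hk, Function.iterate_succ_apply, afterOut]

/-- An induction principle for paths that leave `ξ(H¹)`. -/
theorem induction_kappa_ne_zero {P : OneSided G → Prop}
    (hout : ∀ x : OneSided G, x.val 0 ∉ imageEdges ξ → P x)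
    (hin : ∀ x : OneSided G, x.val 0 ∈ imageEdges ξ → kappa ξ x ≠ 0 → P (shiftPos x) → P x)
    (x : OneSided G) (hk : kappa ξ x ≠ 0) : P x := by
  induction hn : firstOut ξ x generalizing x with
  | zero => exact absurd hn (by simp [firstOut])
  | succ n ih =>
    by_cases h : x.val 0 ∈ imageEdges ξ
    · refine hin x h hk (ih _ (by rwa [kappa_shift_of_mem ξ h]) ?_)
      have := firstOut_of_mem ξ h hk
      omega
    · exact hout x h

theorem kappa_afterOut (x : OneSided G) (hk : kappa ξ x ≠ 0) :
    kappa ξ x = kappa ξ (afterOut ξ x) + 1 := by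
  classical
  refine induction_kappa_ne_zero ξ (P := fun x => kappa ξ x = kappa ξ (afterOut ξ x) + 1)
    (fun x h => ?_) (fun x h hk ih => ?_) x hk
  · rw [afterOut_of_notMem ξ h, kappa_eq_shift ξ x, if_neg h]
  · rw [afterOut_of_mem ξ h hk, ← ih, kappa_shift_of_mem ξ h]

open Classical in
/-- `2^{-n(x)}`, which is `0` if `x` stays in `ξ(H¹)`. -/
noncomputable def invOut (x : OneSided G) : ℝ :=
  if kappa ξ x = 0 then 0 else (2 : ℝ)⁻¹ ^ firstOut ξ x

theorem invOut_of_notMem {x : OneSided G} (h : x.val 0 ∉ imageEdges ξ) : invOut ξ x = 2⁻¹ := by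
  rw [invOut, if_neg (kappa_ne_zero_of_notMem ξ h), firstOut_of_notMem ξ h, pow_one]

/-- The value `0` for paths that stay in `ξ(H¹)` is compatible with halving, so no assumption on `κ`
is needed. -/
theorem invOut_of_mem {x : OneSided G} (h : x.val 0 ∈ imageEdges ξ) :
    invOut ξ x = invOut ξ (shiftPos x) / 2 := by
  unfold invOut
  rw [kappa_shift_of_mem ξ h]
  split_ifs with hk
  · simp
  · rw [firstOut_of_mem ξ h hk, pow_succ, div_eq_mul_inv]

theorem invOut_nonneg (x : OneSided G) : 0 ≤ invOut ξ x := by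
  unfold invOut
  split_ifs <;> positivity

theorem invOut_le (x : OneSided G) : invOut ξ x ≤ 2⁻¹ := by
  unfold invOut
  split_ifs
  · positivity
  · rw [firstOut, pow_succ]
    have : (2 : ℝ)⁻¹ ^ sInf {n : ℕ | x.val n ∉ imageEdges ξ} ≤ 1 :=
      pow_le_one₀ (by norm_num) (by norm_num)
    linarith

theorem invOut_ne_zero_iff {x : OneSided G} : invOut ξ x ≠ 0 ↔ kappa ξ x ≠ 0 := by
  unfold invOut
  split_ifs with h <;> simp [h]

theorem invOut_eq_iff {x y : OneSided G} (hx : kappa ξ x ≠ 0) (hy : kappa ξ y ≠ 0) :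
    invOut ξ x = invOut ξ y ↔ firstOut ξ x = firstOut ξ y := by
  unfold invOut
  rw [if_neg hx, if_neg hy]
  exact (pow_right_injective₀ (by norm_num : (0 : ℝ) < 2⁻¹) (by norm_num)).eq_iff

theorem summable_eps (x : OneSided G) :
    Summable fun k : ℕ => eps ξ (x.val k) * (2 : ℝ)⁻¹ ^ (k + 1) := by
  refine Summable.of_nonneg_of_le (fun k => mul_nonneg (eps_nonneg ξ _) (by positivity))
    (fun k => ?_) (hasSum_geometric_two' 1).summable
  rw [pow_succ, div_div, ← mul_comm (2 ^ k), one_div, mul_inv, ← inv_pow]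
  exact mul_le_of_le_one_left (by positivity) (eps_le_one ξ _)

open Classical in
/-- The real number `Σ ε(x_j) 2^{-j}`, summed over `1 ≤ j < n(x)`. -/
noncomputable def digitSum (x : OneSided G) : ℝ :=
  if kappa ξ x = 0 then ∑' k : ℕ, eps ξ (x.val k) * (2 : ℝ)⁻¹ ^ (k + 1)
  else ∑ k ∈ Finset.range (firstOut ξ x - 1), eps ξ (x.val k) * (2 : ℝ)⁻¹ ^ (k + 1)

theorem digitSum_of_notMem {x : OneSided G} (h : x.val 0 ∉ imageEdges ξ) : digitSum ξ x = 0 := by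
  rw [digitSum, if_neg (kappa_ne_zero_of_notMem ξ h), firstOut_of_notMem ξ h]
  simp

theorem digitSum_of_mem {x : OneSided G} (h : x.val 0 ∈ imageEdges ξ) :
    digitSum ξ x = (eps ξ (x.val 0) + digitSum ξ (shiftPos x)) / 2 := by
  unfold digitSum
  rw [kappa_shift_of_mem ξ h]
  have hs : ∀ k, eps ξ (x.val (k + 1)) * (2 : ℝ)⁻¹ ^ (k + 1 + 1) =
      eps ξ ((shiftPos x).val k) * (2 : ℝ)⁻¹ ^ (k + 1) / 2 := fun k => by
    simp only [shiftPos]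
    ring
  split_ifs with hk
  · rw [(summable_eps ξ x).tsum_eq_zero_add]
    simp only [hs, tsum_div_const]
    ring
  · rw [firstOut_of_mem ξ h hk, show firstOut ξ (shiftPos x) + 1 - 1 =
      (firstOut ξ (shiftPos x) - 1) + 1 by simp [firstOut], Finset.sum_range_succ']
    simp only [hs, ← Finset.sum_div]
    ring

theorem digitSum_nonneg (x : OneSided G) : 0 ≤ digitSum ξ x := by
  unfold digitSum
  split_ifs
  · exact tsum_nonneg fun k => mul_nonneg (eps_nonneg ξ _) (by positivity)
  · exact Finset.sum_nonneg fun k _ => mul_nonneg (eps_nonneg ξ _) (by positivity)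

theorem digitSum_le_one (x : OneSided G) : digitSum ξ x ≤ 1 := by
  have h : ∑' k : ℕ, eps ξ (x.val k) * (2 : ℝ)⁻¹ ^ (k + 1) ≤ 1 := by
    rw [← (hasSum_geometric_two' 1).tsum_eq]
    refine (summable_eps ξ x).tsum_le_tsum (fun k => ?_) (hasSum_geometric_two' 1).summable
    rw [pow_succ, div_div, ← mul_comm (2 ^ k), one_div, mul_inv, ← inv_pow]
    exact mul_le_of_le_one_left (by positivity) (eps_le_one ξ _)
  unfold digitSum
  split_ifs
  · exact h
  · exact ((summable_eps ξ x).sum_le_tsum _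
      fun k _ => mul_nonneg (eps_nonneg ξ _) (by positivity)).trans h

/-- The angle of `θ(x)`, as a point of `ℝ/ℤ`. -/
noncomputable def angle (x : OneSided G) : UnitAddCircle := (digitSum ξ x : UnitAddCircle)

theorem theta_eq (x : OneSided G) :
    theta ξ x = Complex.exp (2 * Real.pi * Complex.I * (digitSum ξ x : ℂ)) := by
  unfold theta digitSum
  split_ifs <;> rfl

theorem dCircle_theta (x y : OneSided G) :
    dCircle (theta ξ x) (theta ξ y) = dist (angle ξ x) (angle ξ y) := by
  rw [theta_eq, theta_eq, dCircle_exp, angle, angle]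

theorem theta_eq_iff (x y : OneSided G) : theta ξ x = theta ξ y ↔ angle ξ x = angle ξ y := by
  rw [theta_eq, theta_eq, exp_two_pi_I_eq_iff, angle, angle, coe_unitAddCircle_eq_iff]

theorem angle_of_notMem {x : OneSided G} (h : x.val 0 ∉ imageEdges ξ) : angle ξ x = 0 := by
  rw [angle, digitSum_of_notMem ξ h, AddCircle.coe_zero]

/-- Doubling moves the first binary digit to the integer part, where it vanishes modulo `1`. -/
theorem two_nsmul_angle {x : OneSided G} (h : x.val 0 ∈ imageEdges ξ) :
    2 • angle ξ x = angle ξ (shiftPos x) := by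
  rw [angle, angle, ← AddCircle.coe_nsmul, coe_unitAddCircle_eq_iff, digitSum_of_mem ξ h]
  rcases eps_eq_zero_or_one ξ (x.val 0) with h | h <;> rw [h]
  · exact ⟨0, by simp; ring⟩
  · exact ⟨1, by simp; ring⟩

theorem abs_digitSum_sub_le {N : ℕ} {x y : OneSided G} (h : Agree N x y) :
    |digitSum ξ x - digitSum ξ y| ≤ (2 : ℝ)⁻¹ ^ N := by
  induction N generalizing x y with
  | zero =>
    rw [pow_zero, abs_le]
    constructor <;>
    linarith [digitSum_nonneg ξ x, digitSum_nonneg ξ y, digitSum_le_one ξ x, digitSum_le_one ξ y]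
  | succ N ih =>
    have h0 := h 0 (by omega)
    by_cases hx : x.val 0 ∈ imageEdges ξ
    · have hy : y.val 0 ∈ imageEdges ξ := h0 ▸ hx
      rw [digitSum_of_mem ξ hx, digitSum_of_mem ξ hy, h0, ← sub_div, add_sub_add_left_eq_sub,
        abs_div, abs_two, pow_succ, ← div_eq_mul_inv]
      have := ih h.shift
      linarith
    · rw [digitSum_of_notMem ξ hx, digitSum_of_notMem ξ (h0 ▸ hx), sub_self, abs_zero]
      positivity

theorem dist_angle_le {N : ℕ} {x y : OneSided G} (h : Agree N x y) :
    dist (angle ξ x) (angle ξ y) ≤ (2 : ℝ)⁻¹ ^ N :=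
  (unitAddCircle_dist_coe_le _ _).trans (abs_digitSum_sub_le ξ h)

end Code

/-! ### Equality of codes, expansiveness, and the relation `∼_ξ`. -/

section SameCode

variable {W F V E : Type*} {H : EdgeGraph W F} {G : EdgeGraph V E} (ξ : Fin 2 → Embedding H G)

/-- All entries of `x` and `y` have the same class in `G_ξ`, and all shifts of `x` and `y` have
the same angle. -/
def SameCode (x y : OneSided G) : Prop :=
  ∀ n, edgeClass ξ (x.val n) = edgeClass ξ (y.val n) ∧
    angle ξ (shiftPos^[n] x) = angle ξ (shiftPos^[n] y)

variable {ξ}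

theorem SameCode.refl (x : OneSided G) : SameCode ξ x x := fun _ => ⟨rfl, rfl⟩

theorem SameCode.symm {x y : OneSided G} (h : SameCode ξ x y) : SameCode ξ y x :=
  fun n => ⟨(h n).1.symm, (h n).2.symm⟩

theorem SameCode.trans {x y z : OneSided G} (h : SameCode ξ x y) (h' : SameCode ξ y z) :
    SameCode ξ x z :=
  fun n => ⟨(h n).1.trans (h' n).1, (h n).2.trans (h' n).2⟩

theorem SameCode.shift {x y : OneSided G} (h : SameCode ξ x y) :
    SameCode ξ (shiftPos x) (shiftPos y) :=
  fun n => ⟨(h (n + 1)).1, (h (n + 1)).2⟩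

theorem SameCode.iterate_shift {x y : OneSided G} (h : SameCode ξ x y) (n : ℕ) :
    SameCode ξ (shiftPos^[n] x) (shiftPos^[n] y) := by
  induction n generalizing x y with
  | zero => exact h
  | succ n ih => exact ih h.shift

theorem SameCode.of_shift {x y : OneSided G} (h : SameCode ξ (shiftPos x) (shiftPos y))
    (h0 : edgeClass ξ (x.val 0) = edgeClass ξ (y.val 0)) (ha : angle ξ x = angle ξ y) :
    SameCode ξ x y := by
  intro n
  cases n with
  | zero => exact ⟨h0, ha⟩
  | succ n => exact h n

/-- A pair of paths whose shifts have the same code has the same code if the angles are less than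
half a circle apart. -/
theorem SameCode.of_shift_of_dist_lt (h1 : range (ξ 0).onE ∩ range (ξ 1).onE = ∅)
    {x y : OneSided G} (h : SameCode ξ (shiftPos x) (shiftPos y))
    (h0 : edgeClass ξ (x.val 0) = edgeClass ξ (y.val 0))
    (hd : dist (angle ξ x) (angle ξ y) < 1 / 2) : SameCode ξ x y := by
  refine h.of_shift h0 ?_
  have hiff := mem_imageEdges_iff_of_edgeClass_eq ξ h1 h0
  by_cases hx : x.val 0 ∈ imageEdges ξ
  · refine eq_of_two_nsmul_eq ?_ hd
    rw [two_nsmul_angle ξ hx, two_nsmul_angle ξ (hiff.1 hx)]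
    exact (h 0).2
  · rw [angle_of_notMem ξ hx, angle_of_notMem ξ (fun hy => hx (hiff.2 hy))]

/-- Inside `ξ(H¹)` a distance of at most `1/4` is doubled exactly by the shift, and outside it both
angles are `0`. Pulling the bound `1/4` back through `n` steps gives at most `2⁻ⁿ` for every `n`. -/
theorem angle_eq_of_dist_le (h1 : range (ξ 0).onE ∩ range (ξ 1).onE = ∅) {x y : OneSided G}
    (h : ∀ n, edgeClass ξ (x.val n) = edgeClass ξ (y.val n))
    (hd : ∀ n, dist (angle ξ (shiftPos^[n] x)) (angle ξ (shiftPos^[n] y)) ≤ 1 / 4) :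
    angle ξ x = angle ξ y := by
  have key : ∀ n : ℕ, ∀ x y : OneSided G,
      (∀ n, edgeClass ξ (x.val n) = edgeClass ξ (y.val n)) →
      (∀ n, dist (angle ξ (shiftPos^[n] x)) (angle ξ (shiftPos^[n] y)) ≤ 1 / 4) →
      dist (angle ξ x) (angle ξ y) ≤ (1 / 2) ^ n := by
    intro n
    induction n with
    | zero =>
      intro x y _ hd
      exact (hd 0).trans (by norm_num)
    | succ n ih =>
      intro x y h hd
      have hiff := mem_imageEdges_iff_of_edgeClass_eq ξ h1 (h 0)
      by_cases hx : x.val 0 ∈ imageEdges ξ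
      · have h2 := dist_two_nsmul (hd 0)
        rw [Function.iterate_zero_apply, Function.iterate_zero_apply, two_nsmul_angle ξ hx,
          two_nsmul_angle ξ (hiff.1 hx)] at h2
        have := ih (shiftPos x) (shiftPos y) (fun n => h (n + 1)) (fun n => hd (n + 1))
        rw [pow_succ]
        linarith
      · rw [angle_of_notMem ξ hx, angle_of_notMem ξ (fun hy => hx (hiff.2 hy)), dist_self]
        positivity
  refine dist_le_zero.1 (ge_of_tendsto' (tendsto_pow_atTop_nhds_zero_of_lt_one
    (r := (1 / 2 : ℝ)) (by norm_num) (by norm_num)) fun n => key n x y h hd)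

/-- Expansiveness: paths with the same image in `G_ξ` have the same code if all their shifts have
angles at most a quarter of a circle apart. -/
theorem SameCode.of_dist_le (h1 : range (ξ 0).onE ∩ range (ξ 1).onE = ∅) {x y : OneSided G}
    (h : ∀ n, edgeClass ξ (x.val n) = edgeClass ξ (y.val n))
    (hd : ∀ n, dist (angle ξ (shiftPos^[n] x)) (angle ξ (shiftPos^[n] y)) ≤ 1 / 4) :
    SameCode ξ x y := by
  refine fun n => ⟨h n, angle_eq_of_dist_le h1 (fun k => ?_) fun k => ?_⟩
  · rw [iterate_shiftPos_val, iterate_shiftPos_val]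
    exact h _
  · rw [← Function.iterate_add_apply, ← Function.iterate_add_apply]
    exact hd _

theorem digitSum_of_forall_onE (h1 : range (ξ 0).onE ∩ range (ξ 1).onE = ∅) {x : OneSided G}
    {i : Fin 2} {y : ℕ → F} (h : ∀ k, x.val k = (ξ i).onE (y k)) : digitSum ξ x = (i : ℕ) := by
  have hk : kappa ξ x = 0 := (kappa_eq_zero_iff ξ).2 fun n => (mem_imageEdges ξ).2 ⟨_, _, h n⟩
  rw [digitSum, if_pos hk]
  simp only [h, eps_onE ξ h1]
  rw [tsum_mul_left, ← mul_one ((i : ℕ) : ℝ)]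
  congr 1
  · simp
  · rw [← (hasSum_geometric_two' 1).tsum_eq]
    congr 1
    ext k
    rw [pow_succ, div_div, ← mul_comm (2 ^ k), one_div, mul_inv, ← inv_pow]

/-- The maximal value `1` is an average of a digit and a digit sum, both at most `1`; so both equal
`1`, and the argument repeats for the shift. -/
theorem forall_onE_of_digitSum_eq_one {x : OneSided G} (h : digitSum ξ x = 1) (n : ℕ) :
    x.val n ∈ range (ξ 1).onE := by
  have step : ∀ x : OneSided G, digitSum ξ x = 1 →
      x.val 0 ∈ range (ξ 1).onE ∧ digitSum ξ (shiftPos x) = 1 := by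
    intro x h
    have hmem : x.val 0 ∈ imageEdges ξ := by
      by_contra hx
      rw [digitSum_of_notMem ξ hx] at h
      norm_num at h
    rw [digitSum_of_mem ξ hmem] at h
    have h2 := digitSum_le_one ξ (shiftPos x)
    have he := eps_le_one ξ (x.val 0)
    refine ⟨?_, by linarith⟩
    by_contra hx
    have : eps ξ (x.val 0) = 0 := if_neg hx
    linarith
  induction n generalizing x with
  | zero => exact (step x h).1
  | succ n ih => exact ih (step x h).2

/-- Unlike the value `1`, the value `0` does not keep the path in `ξ(H¹)`: any path that starts
outside has digit sum `0`. Hence the assumption `hm`. -/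
theorem forall_onE_of_digitSum_eq_zero {x : OneSided G} (h : digitSum ξ x = 0)
    (hm : ∀ n, x.val n ∈ imageEdges ξ) (n : ℕ) : x.val n ∈ range (ξ 0).onE := by
  have step : ∀ x : OneSided G, x.val 0 ∈ imageEdges ξ → digitSum ξ x = 0 →
      x.val 0 ∈ range (ξ 0).onE ∧ digitSum ξ (shiftPos x) = 0 := by
    intro x hmem h
    rw [digitSum_of_mem ξ hmem] at h
    have h2 := digitSum_nonneg ξ (shiftPos x)
    have he := eps_nonneg ξ (x.val 0)
    refine ⟨hmem.resolve_right fun hx => ?_, by linarith⟩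
    have : eps ξ (x.val 0) = 1 := if_pos hx
    linarith
  induction n generalizing x with
  | zero => exact (step x (hm 0) h).1
  | succ n ih => exact ih (step x (hm 0) h).2 fun n => hm (n + 1)

theorem Rel.edgeClass_eq {x y : OneSided G} (h : Rel ξ x y) (n : ℕ) :
    edgeClass ξ (x.val n) = edgeClass ξ (y.val n) := by
  rcases h with rfl | ⟨m, i, z, h1, h2, h3, h4⟩ | ⟨m, i, z, h1, h2, h3⟩
  · rfl
  · rcases lt_trichotomy n m with hn | rfl | hn
    · rw [h1 n hn]
    · rw [h2, h3]
      exact edgeClass_onE ξ _ _ _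
    · rw [(h4 n hn).1, (h4 n hn).2]
      exact edgeClass_onE ξ _ _ _
  · rcases lt_or_ge n m with hn | hn
    · rw [h1 n hn]
    · rw [(h3 n hn).1, (h3 n hn).2]
      exact edgeClass_onE ξ _ _ _

theorem digitSum_eq_of_agree_of_notMem {n : ℕ} {x y : OneSided G} (h : Agree (n + 1) x y)
    (hn : x.val n ∉ imageEdges ξ) : digitSum ξ x = digitSum ξ y := by
  induction n generalizing x y with
  | zero => rw [digitSum_of_notMem ξ hn, digitSum_of_notMem ξ (h 0 (by omega) ▸ hn)]
  | succ n ih =>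
    have h0 := h 0 (by omega)
    by_cases hx : x.val 0 ∈ imageEdges ξ
    · have hy : y.val 0 ∈ imageEdges ξ := h0 ▸ hx
      rw [digitSum_of_mem ξ hx, digitSum_of_mem ξ hy, h0, ih h.shift hn]
    · rw [digitSum_of_notMem ξ hx, digitSum_of_notMem ξ (h0 ▸ hx)]

/-- This is `0.1000… = 0.0111…` in base two, preceded by common digits or cut off by an earlier
exit. -/
theorem Flip₁.digitSum_eq (h1 : range (ξ 0).onE ∩ range (ξ 1).onE = ∅) {x y : OneSided G}
    (h : Flip₁ ξ x y) : digitSum ξ x = digitSum ξ y := by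
  obtain ⟨n, i, z, h2, h3, h4, h5⟩ := h
  induction n generalizing x y z with
  | zero =>
    rw [digitSum_of_mem ξ ((mem_imageEdges ξ).2 ⟨_, _, h3⟩),
      digitSum_of_mem ξ ((mem_imageEdges ξ).2 ⟨_, _, h4⟩), h3, h4, eps_onE ξ h1, eps_onE ξ h1,
      digitSum_of_forall_onE h1 (x := shiftPos x) (y := fun k => z (k + 1))
        fun k => (h5 (k + 1) (by omega)).1,
      digitSum_of_forall_onE h1 (x := shiftPos y) (y := fun k => z (k + 1))
        fun k => (h5 (k + 1) (by omega)).2, add_comm]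
  | succ n ih =>
    have h0 := h2 0 (by omega)
    by_cases hx : x.val 0 ∈ imageEdges ξ
    · have hy : y.val 0 ∈ imageEdges ξ := h0 ▸ hx
      rw [digitSum_of_mem ξ hx, digitSum_of_mem ξ hy, h0,
        ih (x := shiftPos x) (y := shiftPos y) (fun k => z (k + 1))
          (fun k hk => h2 (k + 1) (by omega)) h3 h4 (fun k hk => h5 (k + 1) (by omega))]
    · rw [digitSum_of_notMem ξ hx, digitSum_of_notMem ξ (h0 ▸ hx)]

/-- A `Flip₂` at `n = 0` exchanges the digit sums `0` and `1`, equal only modulo `1`. For `n ≥ 1`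
the exit just before the flip ends both sums while the paths still agree. -/
theorem Rel.angle_eq (h1 : range (ξ 0).onE ∩ range (ξ 1).onE = ∅) {x y : OneSided G}
    (h : Rel ξ x y) : angle ξ x = angle ξ y := by
  rcases h with rfl | h | ⟨n, i, z, h2, h3, h4⟩
  · rfl
  · rw [angle, angle, h.digitSum_eq h1]
  · cases n with
    | zero =>
      rw [angle, angle, digitSum_of_forall_onE h1 fun k => (h4 k (by omega)).1,
        digitSum_of_forall_onE h1 fun k => (h4 k (by omega)).2, coe_unitAddCircle_eq_iff]
      exact ⟨((i : ℕ) : ℤ) - ((1 - i : Fin 2) : ℕ), by push_cast; ring⟩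
    | succ n => rw [angle, angle, digitSum_eq_of_agree_of_notMem h2 (h3 n rfl)]

theorem Rel.sameCode (h1 : range (ξ 0).onE ∩ range (ξ 1).onE = ∅) {x y : OneSided G}
    (h : Rel ξ x y) : SameCode ξ x y := by
  intro n
  refine ⟨h.edgeClass_eq n, ?_⟩
  induction n generalizing x y with
  | zero => exact h.angle_eq h1
  | succ n ih => exact ih h.shift

theorem Flip₁.symm {x y : OneSided G} (h : Flip₁ ξ x y) : Flip₁ ξ y x := by
  obtain ⟨n, i, z, h2, h3, h4, h5⟩ := h
  refine ⟨n, 1 - i, z, fun k hk => (h2 k hk).symm, ?_, h3, fun k hk => ⟨(h5 k hk).2, ?_⟩⟩ <;>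
    rw [fin_two_one_sub_one_sub]
  exacts [h4, (h5 k hk).1]

theorem Flip₂.symm {x y : OneSided G} (h : Flip₂ ξ x y) : Flip₂ ξ y x := by
  obtain ⟨n, i, z, h2, h3, h4⟩ := h
  refine ⟨n, 1 - i, z, fun k hk => (h2 k hk).symm, fun k hk => ?_, fun k hk => ⟨(h4 k hk).2, ?_⟩⟩
  · rw [← h2 k (by omega)]
    exact h3 k hk
  · rw [fin_two_one_sub_one_sub]
    exact (h4 k hk).1

theorem Rel.symm {x y : OneSided G} (h : Rel ξ x y) : Rel ξ y x := by
  rcases h with rfl | h | h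
  exacts [Or.inl rfl, Or.inr (Or.inl h.symm), Or.inr (Or.inr h.symm)]

/-- Let `a` and `b` be the digit sums after the first difference. Equality of angles there reads `(1
+ a)/2 = b/2 + n` with `n` an integer and `a, b ∈ [0, 1]`. So either `n = 0`, `a = 0`, `b = 1`,
which gives `Flip₁`, or `n = 1`, `a = 1`, `b = 0`, which gives `Flip₂`. -/
theorem SameCode.rel_of_first_diff (h1 : range (ξ 0).onE ∩ range (ξ 1).onE = ∅)
    {x y : OneSided G} (h : SameCode ξ x y) {m : ℕ} (hm : Agree m x y) {f : F}
    (hx : x.val m = (ξ 1).onE f) (hy : y.val m = (ξ 0).onE f) : Rel ξ x y := by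
  have hval : ∀ (x : OneSided G) k, (shiftPos (shiftPos^[m] x)).val k = x.val (k + (m + 1)) := by
    intro x k
    rw [← Function.iterate_succ_apply' shiftPos, iterate_shiftPos_val]
  have hx0 : (shiftPos^[m] x).val 0 = (ξ 1).onE f := by
    rw [iterate_shiftPos_val, zero_add, hx]
  have hy0 : (shiftPos^[m] y).val 0 = (ξ 0).onE f := by
    rw [iterate_shiftPos_val, zero_add, hy]
  have hxs := digitSum_of_mem ξ ((mem_imageEdges ξ).2 ⟨_, _, hx0⟩)
  have hys := digitSum_of_mem ξ ((mem_imageEdges ξ).2 ⟨_, _, hy0⟩)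
  rw [hx0, eps_onE ξ h1] at hxs
  rw [hy0, eps_onE ξ h1] at hys
  simp only [Fin.val_one, Nat.cast_one, Fin.val_zero, Nat.cast_zero] at hxs hys
  have b1 := digitSum_nonneg ξ (shiftPos (shiftPos^[m] x))
  have b2 := digitSum_le_one ξ (shiftPos (shiftPos^[m] x))
  have b3 := digitSum_nonneg ξ (shiftPos (shiftPos^[m] y))
  have b4 := digitSum_le_one ξ (shiftPos (shiftPos^[m] y))
  obtain ⟨n, hn⟩ := (coe_unitAddCircle_eq_iff _ _).1 (h m).2
  have n0 : (0 : ℤ) ≤ n := by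
    have : (-1 : ℝ) < n := by linarith
    have : (-1 : ℤ) < n := by exact_mod_cast this
    omega
  have n1 : n ≤ 1 := by exact_mod_cast (show (n : ℝ) ≤ 1 by linarith)
  have himg : ∀ k, (shiftPos (shiftPos^[m] x)).val k ∈ imageEdges ξ ↔
      (shiftPos (shiftPos^[m] y)).val k ∈ imageEdges ξ := fun k => by
    rw [hval, hval]
    exact mem_imageEdges_iff_of_edgeClass_eq ξ h1 (h _).1
  -- Entries of one class that are lifts of opposite type are lifts of the same edge of `H`.
  have partner : ∀ (i : Fin 2) k, x.val k ∈ range (ξ i).onE → y.val k ∈ range (ξ (1 - i)).onE →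
      ∃ z, x.val k = (ξ i).onE z ∧ y.val k = (ξ (1 - i)).onE z := by
    rintro i k ⟨a, ha⟩ ⟨b, hb⟩
    rcases (edgeClass_eq_iff ξ h1).1 (h k).1 with he | ⟨j, c, hc, hc'⟩
    · rw [← ha, ← hb] at he
      exact absurd (onE_inj ξ h1 he).1.symm (fin_two_one_sub_ne i)
    · obtain ⟨rfl, rfl⟩ := onE_inj ξ h1 (ha.trans hc)
      exact ⟨a, hc, hc'⟩
  obtain rfl | rfl : n = 0 ∨ n = 1 := by omega
  · have e1 : digitSum ξ (shiftPos (shiftPos^[m] x)) = 0 := by push_cast at hn; linarith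
    have e2 : digitSum ξ (shiftPos (shiftPos^[m] y)) = 1 := by push_cast at hn; linarith
    have f2 := forall_onE_of_digitSum_eq_one e2
    -- That `x` stays in `ξ(H¹)` is transferred from `y`, whose digit sum is `1`.
    have f1 := forall_onE_of_digitSum_eq_zero e1 fun k => (himg k).2 (Or.inr (f2 k))
    have hz : ∀ k, ∃ z, m < k → x.val k = (ξ 0).onE z ∧ y.val k = (ξ (1 - 0)).onE z := by
      intro k
      by_cases hk : m < k
      · obtain ⟨l, rfl⟩ : ∃ l, k = l + (m + 1) := ⟨k - (m + 1), by omega⟩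
        obtain ⟨z, hz⟩ := partner 0 _ (hval x l ▸ f1 l) (hval y l ▸ f2 l)
        exact ⟨z, fun _ => hz⟩
      · exact ⟨f, fun h => absurd h hk⟩
    choose z hz using hz
    classical
    refine Or.inr (Or.inl ⟨m, 0, Function.update z m f, hm, ?_, ?_, fun k hk => ?_⟩)
    · rw [Function.update_self]; exact hx
    · rw [Function.update_self]; exact hy
    · rw [Function.update_of_ne (by omega)]; exact hz k hk
  · have e1 : digitSum ξ (shiftPos (shiftPos^[m] x)) = 1 := by push_cast at hn; linarith
    have e2 : digitSum ξ (shiftPos (shiftPos^[m] y)) = 0 := by push_cast at hn; linarith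
    have f1 := forall_onE_of_digitSum_eq_one e1
    have f2 := forall_onE_of_digitSum_eq_zero e2 fun k => (himg k).1 (Or.inr (f1 k))
    have hz : ∀ k, ∃ z, m ≤ k → x.val k = (ξ 1).onE z ∧ y.val k = (ξ (1 - 1)).onE z := by
      intro k
      rcases lt_trichotomy k m with hk | rfl | hk
      · exact ⟨f, fun h => absurd h (by omega)⟩
      · exact ⟨f, fun _ => ⟨hx, hy⟩⟩
      · obtain ⟨l, rfl⟩ : ∃ l, k = l + (m + 1) := ⟨k - (m + 1), by omega⟩
        obtain ⟨z, hz⟩ := partner 1 _ (hval x l ▸ f1 l) (hval y l ▸ f2 l)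
        exact ⟨z, fun _ => hz⟩
    choose z hz using hz
    refine Or.inr (Or.inr ⟨m, 1, z, hm, ?_, hz⟩)
    rintro k rfl hk
    have hky : y.val k ∈ imageEdges ξ := hm k (by omega) ▸ hk
    have hxk : (shiftPos^[k] x).val 0 ∈ imageEdges ξ := by
      rwa [iterate_shiftPos_val, zero_add]
    have hyk : (shiftPos^[k] y).val 0 ∈ imageEdges ξ := by
      rwa [iterate_shiftPos_val, zero_add]
    -- If the common entry before the flip lay in `ξ(H¹)`, the digit sums from there on would differ
    -- by `1/2`, so the angles would differ.
    obtain ⟨n, hn'⟩ := (coe_unitAddCircle_eq_iff _ _).1 (h k).2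
    rw [digitSum_of_mem ξ hxk, digitSum_of_mem ξ hyk, ← Function.iterate_succ_apply' shiftPos,
      ← Function.iterate_succ_apply' shiftPos, iterate_shiftPos_val, iterate_shiftPos_val, zero_add,
      hm k (by omega)] at hn'
    have h2 : (2 * n : ℝ) = 1 := by linarith
    have h3 : 2 * n = 1 := by exact_mod_cast h2
    omega

/-- Equality of codes is visibly an equivalence relation, whereas transitivity of `∼_ξ` is not
evident from the flips. This is what identifies the fibres of the quotient map in `piPos_eq_iff`. -/
theorem rel_iff_sameCode (h1 : range (ξ 0).onE ∩ range (ξ 1).onE = ∅) {x y : OneSided G} :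
    Rel ξ x y ↔ SameCode ξ x y := by
  classical
  refine ⟨fun h => h.sameCode h1, fun h => ?_⟩
  by_cases hxy : x = y
  · exact Or.inl hxy
  have hex : ∃ n, x.val n ≠ y.val n := by
    by_contra! hn
    exact hxy (OneSided.ext (funext hn))
  have hm : Agree (Nat.find hex) x y := fun k hk => not_not.1 (Nat.find_min hex hk)
  rcases (edgeClass_eq_iff ξ h1).1 (h (Nat.find hex)).1 with he | ⟨i, f, hx, hy⟩
  · exact absurd he (Nat.find_spec hex)
  · rcases fin_two_eq_zero_or_one i with rfl | rfl
    · exact (h.symm.rel_of_first_diff h1 hm.symm hy hx).symm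
    · exact h.rel_of_first_diff h1 hm hx hy

theorem piPos_eq_iff (h1 : range (ξ 0).onE ∩ range (ξ 1).onE = ∅) {x y : OneSided G} :
    piPos ξ x = piPos ξ y ↔ Rel ξ x y := by
  refine ⟨fun h => (rel_iff_sameCode h1).2 ?_, fun h => Quot.sound h⟩
  induction Quot.eqvGen_exact h with
  | rel x y hxy => exact hxy.sameCode h1
  | refl x => exact SameCode.refl x
  | symm x y hxy ih => exact (ih h.symm).symm
  | trans x y z hxy hyz ih1 ih2 =>
    exact (ih1 (Quot.eqvGen_sound hxy)).trans (ih2 (Quot.eqvGen_sound hyz))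

end SameCode

/-! ### A single series for all the functions `λ_k`, and its continuity. -/

section Lambda

variable {W F V E : Type*} {H : EdgeGraph W F} {G : EdgeGraph V E} (ξ : Fin 2 → Embedding H G)

open Classical in
/-- The contribution to `λ` of the `k`-th entry outside `ξ(H¹)`. -/
noncomputable def lamTerm : ℕ → OneSided G → OneSided G → ℝ
  | 0, x, y => |invOut ξ x - invOut ξ y| + dist (angle ξ x) (angle ξ y)
  | k + 1, x, y =>
      if invOut ξ x ≠ 0 ∧ invOut ξ x = invOut ξ y ∧ angle ξ x = angle ξ y then
        invOut ξ x / 4 * lamTerm k (afterOut ξ x) (afterOut ξ y)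
      else 0

/-- The common extension of the functions `λ_k` to all pairs of one-sided paths. -/
noncomputable def lamInf (x y : OneSided G) : ℝ := ∑' k, lamTerm ξ k x y

theorem lamTerm_nonneg (k : ℕ) (x y : OneSided G) : 0 ≤ lamTerm ξ k x y := by
  induction k generalizing x y with
  | zero => exact add_nonneg (abs_nonneg _) dist_nonneg
  | succ k ih =>
    unfold lamTerm
    split_ifs
    · exact mul_nonneg (div_nonneg (invOut_nonneg ξ x) (by norm_num)) (ih _ _)
    · rfl

theorem lamTerm_zero_le_one (x y : OneSided G) : lamTerm ξ 0 x y ≤ 1 := by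
  have h1 : |invOut ξ x - invOut ξ y| ≤ 1 / 2 := by
    rw [abs_le]
    constructor <;> linarith [invOut_nonneg ξ x, invOut_nonneg ξ y, invOut_le ξ x, invOut_le ξ y]
  have h2 := unitAddCircle_dist_le_half (angle ξ x) (angle ξ y)
  unfold lamTerm
  linarith

theorem lamTerm_le (k : ℕ) (x y : OneSided G) : lamTerm ξ k x y ≤ (1 / 8) ^ k := by
  induction k generalizing x y with
  | zero => simpa using lamTerm_zero_le_one ξ x y
  | succ k ih =>
    unfold lamTerm
    split_ifs
    · rw [pow_succ, mul_comm]
      exact mul_le_mul (ih _ _) (by linarith [invOut_le ξ x])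
        (by linarith [invOut_nonneg ξ x]) (by positivity)
    · positivity

theorem summable_lamTerm (x y : OneSided G) : Summable fun k => lamTerm ξ k x y :=
  Summable.of_nonneg_of_le (fun k => lamTerm_nonneg ξ k x y) (fun k => lamTerm_le ξ k x y)
    (summable_geometric_of_lt_one (by norm_num) (by norm_num))

theorem lamInf_nonneg (x y : OneSided G) : 0 ≤ lamInf ξ x y :=
  tsum_nonneg fun k => lamTerm_nonneg ξ k x y

open Classical in
theorem lamInf_eq (x y : OneSided G) :
    lamInf ξ x y = |invOut ξ x - invOut ξ y| + dist (angle ξ x) (angle ξ y) +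
      if invOut ξ x ≠ 0 ∧ invOut ξ x = invOut ξ y ∧ angle ξ x = angle ξ y then
        invOut ξ x / 4 * lamInf ξ (afterOut ξ x) (afterOut ξ y)
      else 0 := by
  rw [lamInf, (summable_lamTerm ξ x y).tsum_eq_zero_add]
  congr 1
  simp only [lamTerm]
  split_ifs
  · rw [tsum_mul_left, lamInf]
  · exact tsum_zero

theorem lamInf_le_one (x y : OneSided G) : lamInf ξ x y ≤ 1 := by
  classical
  -- The geometric bound is improved by the recursion: either the leading term vanishes and the rest
  -- is at most `(1/8)·(8/7)`, or only the leading term is present.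
  have hb : ∀ x y : OneSided G, lamInf ξ x y ≤ 8 / 7 := by
    intro x y
    refine ((summable_lamTerm ξ x y).tsum_le_tsum (lamTerm_le ξ · x y)
      (summable_geometric_of_lt_one (by norm_num) (by norm_num))).trans ?_
    rw [tsum_geometric_of_lt_one (by norm_num) (by norm_num)]
    norm_num
  rw [lamInf_eq]
  split_ifs with h
  · rw [← h.2.1, ← h.2.2, sub_self, abs_zero, dist_self, zero_add, zero_add]
    have h1 := hb (afterOut ξ x) (afterOut ξ y)
    have h2 := lamInf_nonneg ξ (afterOut ξ x) (afterOut ξ y)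
    have h3 := invOut_le ξ x
    have h4 := invOut_nonneg ξ x
    nlinarith
  · rw [add_zero]
    exact lamTerm_zero_le_one ξ x y

theorem lamInf_self (x : OneSided G) : lamInf ξ x x = 0 := by
  have : ∀ k (x : OneSided G), lamTerm ξ k x x = 0 := by
    intro k
    induction k with
    | zero => intro x; simp [lamTerm]
    | succ k ih => intro x; simp [lamTerm, ih]
  simp [lamInf, this]

theorem lamInf_comm (x y : OneSided G) : lamInf ξ x y = lamInf ξ y x := by
  have : ∀ k (x y : OneSided G), lamTerm ξ k x y = lamTerm ξ k y x := by
    intro k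
    induction k with
    | zero => intro x y; rw [lamTerm, lamTerm, abs_sub_comm, dist_comm]
    | succ k ih =>
      intro x y
      unfold lamTerm
      by_cases h : invOut ξ x ≠ 0 ∧ invOut ξ x = invOut ξ y ∧ angle ξ x = angle ξ y
      · rw [if_pos h, if_pos ⟨h.2.1 ▸ h.1, h.2.1.symm, h.2.2.symm⟩, h.2.1, ih]
      · rw [if_neg h, if_neg]
        rintro ⟨h2, h3, h4⟩
        exact h ⟨h3 ▸ h2, h3.symm, h4.symm⟩
  simp only [lamInf, this _ x y]

theorem dist_angle_le_lamInf (x y : OneSided G) :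
    dist (angle ξ x) (angle ξ y) ≤ lamInf ξ x y := by
  have h := (summable_lamTerm ξ x y).le_tsum 0 fun k _ => lamTerm_nonneg ξ k x y
  have h2 := abs_nonneg (invOut ξ x - invOut ξ y)
  have h3 : lamTerm ξ 0 x y = |invOut ξ x - invOut ξ y| + dist (angle ξ x) (angle ξ y) := rfl
  unfold lamInf
  linarith

/-- If one path leaves `ξ(H¹)` within the common prefix, both do so at the same place with the same
digits. Otherwise neither exit time is below `N + 1`. -/
theorem Agree.code {N : ℕ} {x x' : OneSided G} (h : Agree N x x') :
    (∃ n, n ≤ N ∧ invOut ξ x = (2 : ℝ)⁻¹ ^ n ∧ invOut ξ x = invOut ξ x' ∧ angle ξ x = angle ξ x' ∧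
      n ≠ 0 ∧ Agree (N - n) (afterOut ξ x) (afterOut ξ x')) ∨
    (invOut ξ x ≤ (2 : ℝ)⁻¹ ^ (N + 1) ∧ invOut ξ x' ≤ (2 : ℝ)⁻¹ ^ (N + 1)) := by
  -- The induction uses real digit sums, because the recursion halves them and halving is not well
  -- defined on `ℝ/ℤ`.
  suffices h' : (∃ n, n ≤ N ∧ invOut ξ x = (2 : ℝ)⁻¹ ^ n ∧ invOut ξ x = invOut ξ x' ∧
      digitSum ξ x = digitSum ξ x' ∧ n ≠ 0 ∧ Agree (N - n) (afterOut ξ x) (afterOut ξ x')) ∨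
      (invOut ξ x ≤ (2 : ℝ)⁻¹ ^ (N + 1) ∧ invOut ξ x' ≤ (2 : ℝ)⁻¹ ^ (N + 1)) by
    rcases h' with ⟨n, h1, h2, h3, h4, h5⟩ | h'
    · exact Or.inl ⟨n, h1, h2, h3, by rw [angle, angle, h4], h5⟩
    · exact Or.inr h'
  induction N generalizing x x' with
  | zero => exact Or.inr ⟨by simpa using invOut_le ξ x, by simpa using invOut_le ξ x'⟩
  | succ N ih =>
    have h0 := h 0 (by omega)
    by_cases hx : x.val 0 ∈ imageEdges ξ
    · have hx' : x'.val 0 ∈ imageEdges ξ := h0 ▸ hx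
      rcases ih h.shift with ⟨n, h1, h2, h3, h4, h5, h6⟩ | ⟨h1, h2⟩
      · have hk : kappa ξ (shiftPos x) ≠ 0 :=
          (invOut_ne_zero_iff ξ).1 (by rw [h2]; positivity)
        have hk' : kappa ξ (shiftPos x') ≠ 0 :=
          (invOut_ne_zero_iff ξ).1 (by rw [← h3, h2]; positivity)
        rw [kappa_shift_of_mem ξ hx] at hk
        rw [kappa_shift_of_mem ξ hx'] at hk'
        refine Or.inl ⟨n + 1, by omega, ?_, ?_, ?_, by omega, ?_⟩
        · rw [invOut_of_mem ξ hx, h2, pow_succ, div_eq_mul_inv]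
        · rw [invOut_of_mem ξ hx, invOut_of_mem ξ hx', h3]
        · rw [digitSum_of_mem ξ hx, digitSum_of_mem ξ hx', h4, h0]
        · rwa [Nat.add_sub_add_right, afterOut_of_mem ξ hx hk, afterOut_of_mem ξ hx' hk']
      · refine Or.inr ⟨?_, ?_⟩
        · rw [invOut_of_mem ξ hx, pow_succ, ← div_eq_mul_inv]
          linarith
        · rw [invOut_of_mem ξ hx', pow_succ, ← div_eq_mul_inv]
          linarith
    · have hx' : x'.val 0 ∉ imageEdges ξ := h0 ▸ hx
      refine Or.inl ⟨1, by omega, ?_, ?_, ?_, one_ne_zero, ?_⟩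
      · rw [invOut_of_notMem ξ hx, pow_one]
      · rw [invOut_of_notMem ξ hx, invOut_of_notMem ξ hx']
      · rw [digitSum_of_notMem ξ hx, digitSum_of_notMem ξ hx']
      · rw [afterOut_of_notMem ξ hx, afterOut_of_notMem ξ hx']
        exact h.shift

/-- After a common exit at `n ≤ N` the leading terms cancel and the induction hypothesis enters with
weight `2⁻ⁿ/4`. Without one, the exit times, the angles and the remainders contribute at most
`2⁻ᴺ/2`, `2⁻ᴺ` and `2⁻ᴺ/8`. -/
theorem abs_lamInf_sub_le {N : ℕ} {x x' : OneSided G} (h : Agree N x x') (y : OneSided G) :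
    |lamInf ξ x y - lamInf ξ x' y| ≤ 2 * (2 : ℝ)⁻¹ ^ N := by
  classical
  induction N using Nat.strong_induction_on generalizing x x' y with
  | _ N ih =>
    rw [lamInf_eq ξ x y, lamInf_eq ξ x' y]
    rcases h.code ξ with ⟨n, h1, h2, h3, h4, h5, h6⟩ | ⟨h1, h2⟩
    · rw [← h3, ← h4, add_sub_add_left_eq_sub]
      split_ifs with hc
      · rw [← mul_sub, abs_mul, abs_of_nonneg (div_nonneg (invOut_nonneg ξ x) (by norm_num)), h2]
        have hi := ih (N - n) (by omega) h6 (afterOut ξ y)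
        have hp : (2 : ℝ)⁻¹ ^ N = 2⁻¹ ^ n * 2⁻¹ ^ (N - n) := by
          rw [← pow_add]
          congr 1
          omega
        have hpos : (0 : ℝ) < 2⁻¹ ^ n := by positivity
        have hpos' : (0 : ℝ) < 2⁻¹ ^ (N - n) := by positivity
        rw [hp]
        calc (2 : ℝ)⁻¹ ^ n / 4 * _ ≤ 2⁻¹ ^ n / 4 * (2 * 2⁻¹ ^ (N - n)) := by gcongr
          _ ≤ _ := by nlinarith [mul_pos hpos hpos']
      · rw [sub_self, abs_zero]
        positivity
    · rw [pow_succ] at h1 h2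
      have hd := dist_angle_le ξ h
      have hd' : |dist (angle ξ x) (angle ξ y) - dist (angle ξ x') (angle ξ y)| ≤ 2⁻¹ ^ N :=
        (abs_dist_sub_le _ _ _).trans hd
      have hr : |(|invOut ξ x - invOut ξ y| - |invOut ξ x' - invOut ξ y|)| ≤ 2⁻¹ ^ N * 2⁻¹ := by
        refine (abs_abs_sub_abs_le _ _).trans ?_
        rw [sub_sub_sub_cancel_right, abs_le]
        constructor <;> linarith [invOut_nonneg ξ x, invOut_nonneg ξ x']
      have hterm : ∀ w : OneSided G, invOut ξ w ≤ (2 : ℝ)⁻¹ ^ N * 2⁻¹ →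
          (0 ≤ if invOut ξ w ≠ 0 ∧ invOut ξ w = invOut ξ y ∧ angle ξ w = angle ξ y then
            invOut ξ w / 4 * lamInf ξ (afterOut ξ w) (afterOut ξ y) else 0) ∧
          (if invOut ξ w ≠ 0 ∧ invOut ξ w = invOut ξ y ∧ angle ξ w = angle ξ y then
            invOut ξ w / 4 * lamInf ξ (afterOut ξ w) (afterOut ξ y) else 0) ≤
              (2 : ℝ)⁻¹ ^ N / 8 := by
        intro w hw
        have h3 := lamInf_nonneg ξ (afterOut ξ w) (afterOut ξ y)
        have h4 := lamInf_le_one ξ (afterOut ξ w) (afterOut ξ y)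
        have h5 := invOut_nonneg ξ w
        split_ifs
        · exact ⟨by positivity, by nlinarith⟩
        · exact ⟨le_rfl, by positivity⟩
      obtain ⟨a1, a2⟩ := hterm x h1
      obtain ⟨b1, b2⟩ := hterm x' h2
      have c1 := abs_le.1 hd'
      have c2 := abs_le.1 hr
      rw [abs_le]
      constructor <;> linarith

theorem lamInf_le_of_agree {N : ℕ} {x y : OneSided G} (h : Agree N x y) :
    lamInf ξ x y ≤ 2 * (2 : ℝ)⁻¹ ^ N := by
  have := abs_lamInf_sub_le ξ h y
  rw [lamInf_self, sub_zero] at this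
  exact (le_abs_self _).trans this

/-- The recursion of `lamInf` stops by itself when `κ = 0`, because the weight `invOut` vanishes
there. So one formula serves every level `k`. -/
theorem lam_eq_lamInf (k : ℕ) {x y : OneSided G} (hx : kappa ξ x = k) (hy : kappa ξ y = k) :
    lam ξ k x y = lamInf ξ x y := by
  classical
  induction k generalizing x y with
  | zero =>
    have hx0 : invOut ξ x = 0 := if_pos (by simpa using hx)
    have hy0 : invOut ξ y = 0 := if_pos (by simpa using hy)
    rw [lam, dCircle_theta, lamInf_eq, hx0, hy0]
    simp
  | succ k ih =>
    have hx0 : kappa ξ x ≠ 0 := by rw [hx]; simp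
    have hy0 : kappa ξ y ≠ 0 := by rw [hy]; simp
    rw [lam, dCircle_theta, lamInf_eq]
    have ex : invOut ξ x = (2 : ℝ)⁻¹ ^ firstOut ξ x := if_neg hx0
    have ey : invOut ξ y = (2 : ℝ)⁻¹ ^ firstOut ξ y := if_neg hy0
    have hiff := invOut_eq_iff ξ hx0 hy0
    have hne := (invOut_ne_zero_iff ξ).2 hx0
    have hsub : ∀ w : OneSided G, kappa ξ w = ((k + 1 : ℕ) : ℕ∞) → kappa ξ w ≠ 0 →
        kappa ξ (afterOut ξ w) = k := by
      intro w hw hw0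
      have h := kappa_afterOut ξ w hw0
      rw [hw] at h
      push_cast at h
      exact (ENat.add_left_injective_of_ne_top ENat.one_ne_top h).symm
    by_cases hc : firstOut ξ x = firstOut ξ y ∧ theta ξ x = theta ξ y
    · rw [if_pos hc, if_pos ⟨hne, hiff.2 hc.1, (theta_eq_iff ξ x y).1 hc.2⟩]
      have e := ih (hsub x hx hx0) (hsub y hy hy0)
      rw [afterOut, afterOut] at e ⊢
      rw [e, ex, ey, pow_add]
      ring
    · rw [if_neg hc, if_neg fun h => hc ⟨hiff.1 h.2.1, (theta_eq_iff ξ x y).2 h.2.2⟩, ex, ey]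

variable {ξ}

theorem SameCode.setOf_eq (h1 : range (ξ 0).onE ∩ range (ξ 1).onE = ∅) {x y : OneSided G}
    (h : SameCode ξ x y) :
    {n : ℕ | x.val n ∉ imageEdges ξ} = {n : ℕ | y.val n ∉ imageEdges ξ} := by
  ext n
  exact not_congr (mem_imageEdges_iff_of_edgeClass_eq ξ h1 (h n).1)

theorem SameCode.invOut_eq (h1 : range (ξ 0).onE ∩ range (ξ 1).onE = ∅) {x y : OneSided G}
    (h : SameCode ξ x y) : invOut ξ x = invOut ξ y := by
  unfold invOut kappa firstOut
  rw [h.setOf_eq h1]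

theorem SameCode.afterOut (h1 : range (ξ 0).onE ∩ range (ξ 1).onE = ∅) {x y : OneSided G}
    (h : SameCode ξ x y) : SameCode ξ (afterOut ξ x) (afterOut ξ y) := by
  unfold XiFactor.afterOut
  rw [show firstOut ξ x = firstOut ξ y by unfold firstOut; rw [h.setOf_eq h1]]
  exact h.iterate_shift _

theorem SameCode.lamInf_eq (h1 : range (ξ 0).onE ∩ range (ξ 1).onE = ∅) {x x' y y' : OneSided G}
    (hx : SameCode ξ x x') (hy : SameCode ξ y y') : lamInf ξ x y = lamInf ξ x' y' := by
  have : ∀ k (x x' y y' : OneSided G), SameCode ξ x x' → SameCode ξ y y' →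
      lamTerm ξ k x y = lamTerm ξ k x' y' := by
    intro k
    induction k with
    | zero =>
      intro x x' y y' hx hy
      have ax : angle ξ x = angle ξ x' := (hx 0).2
      have ay : angle ξ y = angle ξ y' := (hy 0).2
      rw [lamTerm, lamTerm, hx.invOut_eq h1, hy.invOut_eq h1, ax, ay]
    | succ k ih =>
      intro x x' y y' hx hy
      have ax : angle ξ x = angle ξ x' := (hx 0).2
      have ay : angle ξ y = angle ξ y' := (hy 0).2
      rw [lamTerm, lamTerm, hx.invOut_eq h1, hy.invOut_eq h1, ax, ay,
        ih _ _ _ _ (hx.afterOut h1) (hy.afterOut h1)]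
  simp only [lamInf, this _ _ _ _ _ hx hy]

end Lambda

/-! ### Density of the paths with prescribed large finite `κ`. -/

section Density

variable {W F V E : Type*} {H : EdgeGraph W F} {G : EdgeGraph V E} (ξ : Fin 2 → Embedding H G)

/-- The path `x` with the edge `e` put in front of it. -/
def consPath (e : E) (x : OneSided G) (h : G.t e = G.i (x.val 0)) : OneSided G :=
  ⟨fun n => Nat.casesOn n e x.val, fun n => by
    cases n with
    | zero => exact h
    | succ n => exact x.isPath n⟩

open Classical in
theorem kappa_consPath (e : E) (x : OneSided G) (h : G.t e = G.i (x.val 0)) :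
    kappa ξ (consPath e x h) = kappa ξ x + if e ∈ imageEdges ξ then 0 else 1 :=
  kappa_eq_shift ξ (consPath e x h)

/-- From the vertex `v` there start paths with every sufficiently large finite number of entries
outside `ξ(H¹)`. -/
def HasManyOut (v : V) : Prop :=
  ∃ A : ℕ, ∀ c : ℕ, ∃ x : OneSided G, G.i (x.val 0) = v ∧ kappa ξ x = ((A + c : ℕ) : ℕ∞)

variable {ξ}

theorem HasManyOut.of_edge {e : E} (h : HasManyOut ξ (G.t e)) : HasManyOut ξ (G.i e) := by
  classical
  obtain ⟨A, hA⟩ := h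
  refine ⟨A + if e ∈ imageEdges ξ then 0 else 1, fun c => ?_⟩
  obtain ⟨x, hx, hk⟩ := hA c
  refine ⟨consPath e x hx.symm, rfl, ?_⟩
  rw [kappa_consPath, hk]
  split_ifs
  · simp
  · push_cast
    ring

/-- A positive entry of the power provides a walk from `v` to `w`, along which the property is
carried back edge by edge. -/
theorem HasManyOut.of_adj_pow [Fintype V] [DecidableEq V] {k : ℕ} {v w : V}
    (hpos : 0 < (G.adj ^ k) w v) (h : HasManyOut ξ w) : HasManyOut ξ v := by
  induction k generalizing w with
  | zero =>
    rw [pow_zero, Matrix.one_apply] at hpos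
    split_ifs at hpos with heq
    · exact heq ▸ h
    · exact absurd hpos (lt_irrefl 0)
  | succ k ih =>
    rw [pow_succ', Matrix.mul_apply] at hpos
    obtain ⟨u, -, hu⟩ := Finset.exists_ne_zero_of_sum_ne_zero hpos.ne'
    have h1 : G.adj w u ≠ 0 := left_ne_zero_of_mul hu
    obtain ⟨⟨⟨e, he, he'⟩⟩, -⟩ := Nat.card_ne_zero.1 h1
    subst he he'
    exact ih (Nat.pos_of_ne_zero (right_ne_zero_of_mul hu)) h.of_edge

/-- By (H2), the first `c` edges of the path `ξ⁰(z)` can be replaced by parallel edges outside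
`ξ(H¹)`. -/
theorem exists_path_over (h2 : ∀ y : F, ∃ x : E, G.t x = G.t ((ξ 0).onE y) ∧
      G.i x = G.i ((ξ 0).onE y) ∧ x ∉ imageEdges ξ) (c : ℕ) (z : OneSided H) :
    ∃ x : OneSided G, G.i (x.val 0) = (ξ 0).onV (H.i (z.val 0)) ∧ kappa ξ x = (c : ℕ∞) := by
  classical
  induction c generalizing z with
  | zero =>
    refine ⟨⟨fun n => (ξ 0).onE (z.val n), fun n => ?_⟩, (ξ 0).map_i _, ?_⟩
    · rw [(ξ 0).map_t, (ξ 0).map_i, z.isPath]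
    · exact (kappa_eq_zero_iff ξ).2 fun n => Or.inl ⟨_, rfl⟩
  | succ c ih =>
    obtain ⟨x, hx, hk⟩ := ih (shiftPos z)
    obtain ⟨e, het, hei, hem⟩ := h2 (z.val 0)
    refine ⟨consPath e x ?_, ?_, ?_⟩
    · rw [het, hx, (ξ 0).map_t, z.isPath]
      rfl
    · exact hei.trans ((ξ 0).map_i _)
    · rw [kappa_consPath, hk, if_neg hem]
      push_cast
      rfl

theorem hasManyOut [Fintype V] [DecidableEq V] (hξ : StandingHypotheses ξ)
    (hH : Nonempty (TwoSided H)) (v : V) : HasManyOut ξ v := by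
  obtain ⟨k, -, hk⟩ := hξ.primitive
  obtain ⟨z⟩ := hH
  refine HasManyOut.of_adj_pow (hk v ((ξ 0).onV (H.i ((tailFrom z 0).val 0)))) ⟨0, fun c => ?_⟩
  rw [zero_add]
  exact exists_path_over hξ.h2 c (tailFrom z 0)

/-- All large counts occur near `x`, not merely infinitely many. This allows the counts near two
different paths to be matched in `dExt_eq`. -/
theorem exists_agree_kappa (h : ∀ v, HasManyOut ξ v) (N : ℕ) (x : OneSided G) :
    ∃ A : ℕ, ∀ c : ℕ, ∃ x' : OneSided G, Agree N x x' ∧ G.i (x'.val 0) = G.i (x.val 0) ∧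
      kappa ξ x' = ((A + c : ℕ) : ℕ∞) := by
  classical
  induction N generalizing x with
  | zero =>
    obtain ⟨A, hA⟩ := h (G.i (x.val 0))
    refine ⟨A, fun c => ?_⟩
    obtain ⟨x', hx', hk⟩ := hA c
    exact ⟨x', fun k hk => absurd hk (by omega), hx', hk⟩
  | succ N ih =>
    obtain ⟨A, hA⟩ := ih (shiftPos x)
    refine ⟨A + if x.val 0 ∈ imageEdges ξ then 0 else 1, fun c => ?_⟩
    obtain ⟨x', ha, hx', hk⟩ := hA c
    refine ⟨consPath (x.val 0) x' (by rw [hx', x.isPath]; rfl), fun k hk => ?_, rfl, ?_⟩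
    · cases k with
      | zero => rfl
      | succ k => exact ha k (by omega)
    · rw [kappa_consPath, hk]
      split_ifs
      · simp
      · push_cast
        ring

end Density

/-! ### The extended pseudo-metric in closed form. -/

section Extension

variable {W F V E : Type*} {H : EdgeGraph W F} {G : EdgeGraph V E} {ξ : Fin 2 → Embedding H G}

theorem Agree.tau {N : ℕ} {x y : OneSided G} (h : Agree N x y) (h0 : (ξ 0).onV = (ξ 1).onV) :
    Agree N (tau ξ h0 x) (tau ξ h0 y) :=
  fun k hk => congrArg (edgeClass ξ) (h k hk)

theorem tendsto_dPos_add_lamInf (h0 : (ξ 0).onV = (ξ 1).onV) (x y : OneSided G) :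
    Tendsto (fun p : OneSided G × OneSided G =>
        dPos (tau ξ h0 p.1) (tau ξ h0 p.2) + lamInf ξ p.1 p.2) (𝓝 (x, y))
      (𝓝 (dPos (tau ξ h0 x) (tau ξ h0 y) + lamInf ξ x y)) := by
  rw [Metric.tendsto_nhds]
  intro η hη
  -- Moving each of the two arguments costs `2⁻ᴺ` in `d_{G_ξ}` and `2·2⁻ᴺ` in `lamInf`, which adds
  -- up to `6·2⁻ᴺ`.
  obtain ⟨N, hN⟩ := exists_pow_lt_of_lt_one (div_pos hη (by norm_num : (0 : ℝ) < 6))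
    (by norm_num : (2 : ℝ)⁻¹ < 1)
  have hx : {x' | Agree N x x'} ∈ 𝓝 x := mem_nhds_oneSided.2 ⟨N, fun _ h => h⟩
  have hy : {y' | Agree N y y'} ∈ 𝓝 y := mem_nhds_oneSided.2 ⟨N, fun _ h => h⟩
  filter_upwards [prod_mem_nhds hx hy]
  rintro ⟨x', y'⟩ ⟨hx', hy'⟩
  change Agree N x x' at hx'
  change Agree N y y' at hy'
  have a1 := abs_le.1 (abs_lamInf_sub_le ξ hx' y)
  have a2 := abs_le.1 (abs_lamInf_sub_le ξ hy' x')
  rw [lamInf_comm ξ y x', lamInf_comm ξ y' x'] at a2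
  have b1 := dPos_le_of_agree (hx'.tau h0)
  have b2 := dPos_le_of_agree (hy'.tau h0)
  have c1 := dPos_triangle (tau ξ h0 x') (tau ξ h0 x) (tau ξ h0 y')
  have c2 := dPos_triangle (tau ξ h0 x) (tau ξ h0 y) (tau ξ h0 y')
  have c3 := dPos_triangle (tau ξ h0 x) (tau ξ h0 x') (tau ξ h0 y)
  have c4 := dPos_triangle (tau ξ h0 x') (tau ξ h0 y') (tau ξ h0 y)
  rw [dPos_comm (tau ξ h0 x') (tau ξ h0 x)] at c1
  rw [dPos_comm (tau ξ h0 y') (tau ξ h0 y)] at c4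
  rw [Real.dist_eq, abs_lt]
  dsimp only
  constructor <;> linarith

/-- On the pairs of equal finite `κ` the closed form is `d_k`. It is continuous and these pairs are
dense, so it is the limit that defines the extension. -/
theorem dExt_eq [Fintype V] [DecidableEq V] (hξ : StandingHypotheses ξ)
    (hH : Nonempty (TwoSided H)) (x y : OneSided G) :
    dExt ξ hξ.h0 x y = dPos (tau ξ hξ.h0 x) (tau ξ hξ.h0 y) + lamInf ξ x y := by
  refine extendFrom_eq ?_ ?_
  · rw [mem_closure_iff_nhds]
    intro t ht
    obtain ⟨u, hu, v, hv, huv⟩ := mem_nhds_prod_iff.1 ht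
    obtain ⟨N, hN⟩ := mem_nhds_oneSided.1 hu
    obtain ⟨M, hM⟩ := mem_nhds_oneSided.1 hv
    obtain ⟨A, hA⟩ := exists_agree_kappa (hasManyOut hξ hH) N x
    obtain ⟨B, hB⟩ := exists_agree_kappa (hasManyOut hξ hH) M y
    -- Both approximations are given the count `A + B`.
    obtain ⟨x', hx', -, hkx⟩ := hA B
    obtain ⟨y', hy', -, hky⟩ := hB A
    refine ⟨(x', y'), huv ⟨hN x' hx', hM y' hy'⟩, ?_, ?_⟩
    · rw [hkx, hky, add_comm]
    · rw [hkx]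
      exact ENat.natCast_ne_top _
  · refine Tendsto.congr' ?_ ((tendsto_dPos_add_lamInf hξ.h0 x y).mono_left nhdsWithin_le_nhds)
    filter_upwards [self_mem_nhdsWithin]
    rintro ⟨x', y'⟩ ⟨hk, htop⟩
    have hx : kappa ξ x' = ((kappa ξ x').toNat : ℕ∞) := (ENat.natCast_toNat htop).symm
    exact congrArg _ (lam_eq_lamInf ξ _ hx (hk.symm.trans hx)).symm

end Extension

/-! ### Bi-infinite paths: metric, stable sets and tails. -/

section TwoSidedMetric

variable {V E : Type*} {G : EdgeGraph V E}

theorem dTwo_nonempty (x y : TwoSided G) :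
    Set.Nonempty {r : ℝ | ∃ n : ℕ, r = (2 : ℝ)⁻¹ ^ n ∧
      ∀ j : ℤ, 1 - (n : ℤ) ≤ j → j ≤ n → x.val j = y.val j} :=
  ⟨1, 0, by simp, fun j h2 h3 => by push_cast at h2 h3; omega⟩

theorem dTwo_nonneg (x y : TwoSided G) : 0 ≤ dTwo x y :=
  le_csInf (dTwo_nonempty x y) (by rintro _ ⟨n, rfl, -⟩; positivity)

theorem dTwo_le {N : ℕ} {x y : TwoSided G}
    (h : ∀ j : ℤ, 1 - (N : ℤ) ≤ j → j ≤ N → x.val j = y.val j) : dTwo x y ≤ (2 : ℝ)⁻¹ ^ N :=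
  csInf_le ⟨0, by rintro _ ⟨n, rfl, -⟩; positivity⟩ ⟨N, rfl, h⟩

theorem eq_of_dTwo_lt {N : ℕ} {x y : TwoSided G} (h : dTwo x y < (2 : ℝ)⁻¹ ^ N) (j : ℤ)
    (hj : -(N : ℤ) ≤ j) (hj' : j ≤ N + 1) : x.val j = y.val j := by
  obtain ⟨r, ⟨n, rfl, hn⟩, hr⟩ := exists_lt_of_csInf_lt (dTwo_nonempty x y) h
  have : N < n := (pow_lt_pow_iff_right_of_lt_one₀ (by norm_num) (by norm_num)).1 hr
  exact hn j (by omega) (by omega)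

theorem iterate_shiftTwo_val (n : ℕ) (x : TwoSided G) (j : ℤ) :
    (shiftTwo^[n] x).val j = x.val (j + n) := by
  induction n generalizing x with
  | zero => simp
  | succ n ih =>
    rw [Function.iterate_succ_apply, ih]
    simp only [shiftTwo]
    congr 1
    push_cast
    ring

/-- Distance below `1` after `n` shifts already forces agreement at coordinate `n`. -/
theorem mem_stableSet_dTwo_iff {x y : TwoSided G} :
    y ∈ stableSet dTwo shiftTwo x ↔ ∃ M : ℤ, ∀ j, M ≤ j → x.val j = y.val j := by
  constructor
  · intro h
    obtain ⟨N, hN⟩ := eventually_atTop.1 ((tendsto_order.1 h).2 ((2 : ℝ)⁻¹ ^ 0) (by norm_num))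
    refine ⟨N, fun j hj => ?_⟩
    obtain ⟨n, rfl⟩ := Int.eq_ofNat_of_zero_le (show 0 ≤ j by omega)
    have := eq_of_dTwo_lt (hN n (by omega)) 0 (by simp) (by simp)
    rwa [iterate_shiftTwo_val, iterate_shiftTwo_val, zero_add] at this
  · rintro ⟨M, hM⟩
    refine squeeze_zero' (g := fun n : ℕ => (2 : ℝ)⁻¹ ^ (n - M.toNat))
      (Eventually.of_forall fun n => dTwo_nonneg _ _) ?_ ?_
    · filter_upwards [eventually_ge_atTop M.toNat] with n hn
      refine dTwo_le fun j hj _ => ?_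
      rw [iterate_shiftTwo_val, iterate_shiftTwo_val]
      exact hM _ (by omega)
    · exact (tendsto_pow_atTop_nhds_zero_of_lt_one (by norm_num) (by norm_num)).comp
        (tendsto_sub_atTop_nat _)

theorem tailFrom_eq_shiftPos (x : TwoSided G) (n : ℕ) :
    tailFrom x n = shiftPos (tailFrom x (n + 1)) := by
  ext k
  simp only [tailFrom, shiftPos]
  congr 1
  push_cast
  ring

theorem tailFrom_shiftTwo (x : TwoSided G) (n : ℕ) :
    tailFrom (shiftTwo x) n = shiftPos (tailFrom x n) := by
  ext k
  simp only [tailFrom, shiftPos, shiftTwo]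
  congr 1
  push_cast
  ring

theorem tailFrom_iterate_shiftTwo (x : TwoSided G) (m n : ℕ) :
    tailFrom (shiftTwo^[m] x) n = shiftPos^[m] (tailFrom x n) := by
  induction m generalizing x with
  | zero => rfl
  | succ m ih => rw [Function.iterate_succ_apply, ih, tailFrom_shiftTwo, ← Function.iterate_succ_apply]

theorem tailFrom_val (x : TwoSided G) (n k : ℕ) :
    (tailFrom x n).val k = x.val (1 + (k : ℤ) - n) := rfl

/-- A compatible sequence of one-sided paths comes from a bi-infinite path. -/
theorem exists_twoSided (s : ℕ → OneSided G) (hs : ∀ n, shiftPos (s (n + 1)) = s n) :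
    ∃ x : TwoSided G, ∀ n, tailFrom x n = s n := by
  have h1 : ∀ n k d, (s n).val k = (s (n + d)).val (k + d) := by
    intro n k d
    induction d with
    | zero => rfl
    | succ d ih => rw [ih, ← hs (n + d)]; rfl
  have h2 : ∀ n m k l : ℕ, (k : ℤ) - n = l - m → (s n).val k = (s m).val l := by
    intro n m k l h
    rcases le_total n m with hnm | hnm
    · rw [h1 n k (m - n), show n + (m - n) = m by omega, show k + (m - n) = l by omega]
    · rw [h1 m l (n - m), show m + (n - m) = n by omega, show l + (n - m) = k by omega]
  -- The least `n` for which `s n` reaches coordinate `j` is `(1 - j).toNat`; the coordinate sits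
  -- there at position `j - 1 + n`.
  refine ⟨⟨fun j => (s (1 - j).toNat).val (j - 1 + (1 - j).toNat).toNat, fun j => ?_⟩,
    fun n => ?_⟩
  · rw [(s (1 - j).toNat).isPath]
    congr 1
    exact h2 _ _ _ _ (by omega)
  · ext k
    exact h2 _ _ _ _ (by omega)

theorem continuous_tailFrom (n : ℕ) : Continuous fun x : TwoSided G => tailFrom x n := by
  let _ : TopologicalSpace E := ⊥
  have hval : Continuous fun x : TwoSided G => x.val := continuous_induced_dom
  refine continuous_induced_rng.2 (continuous_pi fun k => ?_)
  exact (continuous_apply (1 + (k : ℤ) - n)).comp hval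

end TwoSidedMetric

/-! ### The metrics of the two factors, evaluated on images of paths. -/

section FactorMetric

variable {W F V E : Type*} {H : EdgeGraph W F} {G : EdgeGraph V E} {ξ : Fin 2 → Embedding H G}

/-- The pseudo-metric `d` on one-sided paths, in closed form. -/
noncomputable def dOne (h0 : (ξ 0).onV = (ξ 1).onV) (x y : OneSided G) : ℝ :=
  dPos (tau ξ h0 x) (tau ξ h0 y) + lamInf ξ x y

theorem dOne_nonneg (h0 : (ξ 0).onV = (ξ 1).onV) (x y : OneSided G) : 0 ≤ dOne h0 x y :=
  add_nonneg (dPos_nonneg _ _) (lamInf_nonneg ξ _ _)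

theorem dOne_le_two (h0 : (ξ 0).onV = (ξ 1).onV) (x y : OneSided G) : dOne h0 x y ≤ 2 := by
  have h1 := dPos_le_one (tau ξ h0 x) (tau ξ h0 y)
  have h2 := lamInf_le_one ξ x y
  unfold dOne
  linarith

theorem dOne_le_of_agree (h0 : (ξ 0).onV = (ξ 1).onV) {N : ℕ} {x y : OneSided G}
    (h : Agree N x y) : dOne h0 x y ≤ 3 * (2 : ℝ)⁻¹ ^ N := by
  have h1 := dPos_le_of_agree (h.tau h0)
  have h2 := lamInf_le_of_agree ξ h
  unfold dOne
  linarith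

theorem edgeClass_eq_of_dOne_lt_one (h0 : (ξ 0).onV = (ξ 1).onV) {x y : OneSided G}
    (h : dOne h0 x y < 1) : edgeClass ξ (x.val 0) = edgeClass ξ (y.val 0) := by
  have h1 : dPos (tau ξ h0 x) (tau ξ h0 y) < (2 : ℝ)⁻¹ ^ 0 := by
    have := lamInf_nonneg ξ x y
    unfold dOne at h
    rw [pow_zero]
    linarith
  exact agree_of_dPos_lt h1 0 (by omega)

theorem dist_angle_le_dOne (h0 : (ξ 0).onV = (ξ 1).onV) (x y : OneSided G) :
    dist (angle ξ x) (angle ξ y) ≤ dOne h0 x y :=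
  (dist_angle_le_lamInf ξ x y).trans (le_add_of_nonneg_left (dPos_nonneg _ _))

theorem piTwo_eq_iff (h1 : range (ξ 0).onE ∩ range (ξ 1).onE = ∅) {x y : TwoSided G} :
    piTwo ξ x = piTwo ξ y ↔ ∀ n, Rel ξ (tailFrom x n) (tailFrom y n) := by
  rw [InvLim.ext_iff, funext_iff]
  exact forall_congr' fun n => piPos_eq_iff h1

theorem piTwo_shiftTwo (x : TwoSided G) : piTwo ξ (shiftTwo x) = shiftLim ξ (piTwo ξ x) := by
  ext n
  exact congrArg (piPos ξ) (tailFrom_shiftTwo x n)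

theorem piTwo_iterate_shiftTwo (n : ℕ) (x : TwoSided G) :
    (shiftLim ξ)^[n] (piTwo ξ x) = piTwo ξ (shiftTwo^[n] x) :=
  ((Function.Semiconj.iterate_right (f := piTwo ξ) (fun x => piTwo_shiftTwo x) n) x).symm

theorem continuous_piTwo : Continuous (piTwo ξ) :=
  continuous_induced_rng.2 (continuous_pi fun n =>
    (continuous_quot_mk (r := Rel ξ)).comp (continuous_tailFrom n))

variable [Fintype V] [DecidableEq V]

/-- Both summands depend only on codes, so the chosen representatives do not matter. -/
theorem dQuot_piPos (hξ : StandingHypotheses ξ) (hH : Nonempty (TwoSided H)) (x y : OneSided G) :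
    dQuot ξ hξ.h0 (piPos ξ x) (piPos ξ y) = dOne hξ.h0 x y := by
  have hout : ∀ w : OneSided G, SameCode ξ (Quot.out (piPos ξ w)) w := fun w =>
    (rel_iff_sameCode hξ.h1).1 ((piPos_eq_iff hξ.h1).1 (Quot.out_eq (piPos ξ w)))
  have htau : ∀ w : OneSided G, tau ξ hξ.h0 (Quot.out (piPos ξ w)) = tau ξ hξ.h0 w := fun w =>
    OneSided.ext (funext fun n => (hout w n).1)
  rw [dQuot, dExt_eq hξ hH, htau, htau, (hout x).lamInf_eq hξ.h1 (hout y), dOne]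

theorem dQuot_piTwo (hξ : StandingHypotheses ξ) (hH : Nonempty (TwoSided H)) (x y : TwoSided G)
    (n : ℕ) : dQuot ξ hξ.h0 ((piTwo ξ x).val n) ((piTwo ξ y).val n) =
      dOne hξ.h0 (tailFrom x n) (tailFrom y n) :=
  dQuot_piPos hξ hH _ _

theorem dLim_piTwo (hξ : StandingHypotheses ξ) (hH : Nonempty (TwoSided H)) (x y : TwoSided G) :
    dLim ξ hξ.h0 (piTwo ξ x) (piTwo ξ y) =
      ⨆ n : ℕ, (2 : ℝ)⁻¹ ^ n * dOne hξ.h0 (tailFrom x n) (tailFrom y n) := by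
  simp only [dLim, dQuot_piTwo hξ hH]

theorem dOne_le_dLim (hξ : StandingHypotheses ξ) (hH : Nonempty (TwoSided H)) (x y : TwoSided G) :
    dOne hξ.h0 (tailFrom x 0) (tailFrom y 0) ≤ dLim ξ hξ.h0 (piTwo ξ x) (piTwo ξ y) := by
  rw [dLim_piTwo hξ hH]
  have hb : BddAbove (range fun n : ℕ =>
      (2 : ℝ)⁻¹ ^ n * dOne hξ.h0 (tailFrom x n) (tailFrom y n)) := by
    refine ⟨2, ?_⟩
    rintro _ ⟨n, rfl⟩
    exact (mul_le_of_le_one_left (dOne_nonneg _ _ _)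
      (pow_le_one₀ (by norm_num) (by norm_num))).trans (dOne_le_two _ _ _)
  simpa using le_ciSup hb 0

theorem dLim_nonneg (hξ : StandingHypotheses ξ) (hH : Nonempty (TwoSided H)) (x y : TwoSided G) :
    0 ≤ dLim ξ hξ.h0 (piTwo ξ x) (piTwo ξ y) :=
  (dOne_nonneg _ _ _).trans (dOne_le_dLim hξ hH x y)

/-- For `n ≤ N` the tails agree in `N` entries; for `n ≥ N` the weight `2⁻ⁿ` suffices against the
diameter bound `2`. -/
theorem dLim_le (hξ : StandingHypotheses ξ) (hH : Nonempty (TwoSided H)) {N : ℕ}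
    {x y : TwoSided G} (h : ∀ j : ℤ, 1 - (N : ℤ) ≤ j → j ≤ N → x.val j = y.val j) :
    dLim ξ hξ.h0 (piTwo ξ x) (piTwo ξ y) ≤ 3 * (2 : ℝ)⁻¹ ^ N := by
  rw [dLim_piTwo hξ hH]
  refine ciSup_le fun n => ?_
  rcases le_total n N with hn | hn
  · have ha : Agree N (tailFrom x n) (tailFrom y n) := fun k hk => h _ (by omega) (by omega)
    exact (mul_le_of_le_one_left (dOne_nonneg _ _ _)
      (pow_le_one₀ (by norm_num) (by norm_num))).trans (dOne_le_of_agree _ ha)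
  · have h1 : (2 : ℝ)⁻¹ ^ n ≤ 2⁻¹ ^ N := pow_le_pow_of_le_one (by norm_num) (by norm_num) hn
    have h2 := dOne_le_two hξ.h0 (tailFrom x n) (tailFrom y n)
    have h3 := dOne_nonneg hξ.h0 (tailFrom x n) (tailFrom y n)
    have h4 : (0 : ℝ) < 2⁻¹ ^ N := by positivity
    calc (2 : ℝ)⁻¹ ^ n * _ ≤ 2⁻¹ ^ N * 2 := by gcongr
      _ ≤ _ := by linarith

end FactorMetric

/-! ### The fibres of `π_ξ`. -/

section Fibres

variable {W F V E : Type*} {H : EdgeGraph W F} {G : EdgeGraph V E} {ξ : Fin 2 → Embedding H G}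

variable (ξ) in
/-- The sequences `a` and `b` are eventually of the form `ξ^i(z)` and `ξ^{1-i}(z)`. -/
def EventuallyFlipped (a b : ℕ → E) : Prop :=
  ∃ (M : ℕ) (i : Fin 2), ∀ k, M ≤ k → ∃ f : F, a k = (ξ i).onE f ∧ b k = (ξ (1 - i)).onE f

theorem Rel.eventuallyFlipped {x y : OneSided G} (h : Rel ξ x y) (hne : x ≠ y) :
    EventuallyFlipped ξ x.val y.val := by
  rcases h with rfl | ⟨n, i, z, -, -, -, h⟩ | ⟨n, i, z, -, -, h⟩
  · exact absurd rfl hne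
  · exact ⟨n + 1, i, fun k hk => ⟨z k, h k (by omega)⟩⟩
  · exact ⟨n, i, fun k hk => ⟨z k, h k hk⟩⟩

theorem EventuallyFlipped.exists_ne (h1 : range (ξ 0).onE ∩ range (ξ 1).onE = ∅) {a b : ℕ → E}
    (h : EventuallyFlipped ξ a b) : ∃ M, ∀ k, M ≤ k → a k ≠ b k := by
  obtain ⟨M, i, h⟩ := h
  refine ⟨M, fun k hk he => ?_⟩
  obtain ⟨f, ha, hb⟩ := h k hk
  exact fin_two_one_sub_ne i (onE_inj ξ h1 (ha.symm.trans (he.trans hb))).1.symm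

/-- Two sequences that are both eventually opposite to `a` carry the same lift of the same edge, so
they are not opposite to each other. -/
theorem EventuallyFlipped.not_three (h1 : range (ξ 0).onE ∩ range (ξ 1).onE = ∅) {a b c : ℕ → E}
    (hab : EventuallyFlipped ξ a b) (hac : EventuallyFlipped ξ a c)
    (hbc : EventuallyFlipped ξ b c) : False := by
  obtain ⟨M₁, i, h⟩ := hab
  obtain ⟨M₂, j, h'⟩ := hac
  obtain ⟨M₃, h''⟩ := hbc.exists_ne h1
  obtain ⟨f, ha, hb⟩ := h (M₁ + M₂ + M₃) (by omega)
  obtain ⟨g, ha', hc⟩ := h' (M₁ + M₂ + M₃) (by omega)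
  obtain ⟨rfl, rfl⟩ := onE_inj ξ h1 (ha.symm.trans ha')
  exact h'' _ (by omega) (hb.trans hc.symm)

theorem encard_le_two_of_eventuallyFlipped (h1 : range (ξ 0).onE ∩ range (ξ 1).onE = ∅)
    {α : Type*} {s : Set α} (f : α → ℕ → E)
    (h : ∀ a ∈ s, ∀ b ∈ s, a ≠ b → EventuallyFlipped ξ (f a) (f b)) : s.encard ≤ 2 := by
  by_contra! hlt
  obtain ⟨t, hts, ht⟩ := Set.exists_subset_encard_eq (k := 3) (Order.add_one_le_of_lt hlt)
  obtain ⟨a, b, c, hab, hac, hbc, rfl⟩ := Set.encard_eq_three.1 ht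
  have ha : a ∈ s := hts (by simp)
  have hb : b ∈ s := hts (by simp)
  have hc : c ∈ s := hts (by simp)
  exact (h a ha b hb hab).not_three h1 (h a ha c hc hac) (h b hb c hc hbc)

theorem onV_eq (h0 : (ξ 0).onV = (ξ 1).onV) (i j : Fin 2) : (ξ i).onV = (ξ j).onV := by
  rcases fin_two_eq_zero_or_one i with rfl | rfl <;>
    rcases fin_two_eq_zero_or_one j with rfl | rfl <;> simp [h0]

theorem composable_of_onE (h0 : (ξ 0).onV = (ξ 1).onV) {i j : Fin 2} {a b : F}
    (h : G.t ((ξ i).onE a) = G.i ((ξ j).onE b)) : H.t a = H.i b := by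
  rw [(ξ i).map_t, (ξ j).map_i, onV_eq h0 i j] at h
  exact (ξ j).injV h

theorem FullFlip.eventuallyFlipped {x y : TwoSided G} (h : FullFlip ξ x y) :
    EventuallyFlipped ξ (tailFrom x 0).val (tailFrom y 0).val := by
  obtain ⟨i, z, h⟩ := h
  exact ⟨0, i, fun k _ => ⟨_, h _⟩⟩

theorem TailFlip.eventuallyFlipped {x y : TwoSided G} (h : TailFlip ξ x y) :
    EventuallyFlipped ξ (tailFrom x 0).val (tailFrom y 0).val := by
  obtain ⟨m, i, z, -, -, h⟩ := h
  refine ⟨m.toNat, i, fun k hk => ⟨z.val (k - m).toNat, ?_⟩⟩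
  have := h (k - m).toNat
  rwa [show m + 1 + ((k - m).toNat : ℤ) = 1 + k - (0 : ℕ) by push_cast; omega] at this

theorem FullFlip.piTwo_eq {x y : TwoSided G} (h : FullFlip ξ x y) : piTwo ξ x = piTwo ξ y := by
  obtain ⟨i, z, h⟩ := h
  ext n
  exact Quot.sound (Or.inr (Or.inr ⟨0, i, fun k => z.val (1 + (k : ℤ) - n),
    fun k hk => absurd hk (by omega), fun k hk => absurd hk (by omega), fun k _ => h _⟩))

theorem TailFlip.piTwo_eq {x y : TwoSided G} (h : TailFlip ξ x y) : piTwo ξ x = piTwo ξ y := by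
  obtain ⟨m, i, z, h1, h2, h3⟩ := h
  have h3' : ∀ j : ℤ, m < j → x.val j = (ξ i).onE (z.val (j - m - 1).toNat) ∧
      y.val j = (ξ (1 - i)).onE (z.val (j - m - 1).toNat) := fun j hj => by
    have := h3 (j - m - 1).toNat
    rwa [show m + 1 + ((j - m - 1).toNat : ℤ) = j by omega] at this
  ext n
  refine Quot.sound ?_
  rcases lt_or_ge m (1 - (n : ℤ)) with hm | hm
  · exact Or.inr (Or.inr ⟨0, i, fun k => z.val (1 + (k : ℤ) - n - m - 1).toNat,
      fun k hk => absurd hk (by omega), fun k hk => absurd hk (by omega),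
      fun k _ => h3' _ (by omega)⟩)
  · obtain ⟨p, hp⟩ := Int.eq_ofNat_of_zero_le (show 0 ≤ m - (1 - (n : ℤ)) by omega)
    have hpm : 1 + (p : ℤ) - n = m := by omega
    rcases h2 with ⟨h4, h5⟩ | ⟨e, -, h4, h5⟩
    · refine Or.inr (Or.inr ⟨p + 1, i, fun k => z.val (1 + (k : ℤ) - n - m - 1).toNat,
        fun k hk => ?_, fun k hk => ?_, fun k hk => h3' _ (by omega)⟩)
      · rcases Nat.lt_succ_iff_lt_or_eq.1 hk with hk | rfl
        · exact h1 _ (by omega)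
        · rw [tailFrom_val, tailFrom_val, hpm, h4]
      · obtain rfl : k = p := by omega
        rwa [tailFrom_val, hpm]
    · classical
      refine Or.inr (Or.inl ⟨p, i,
        Function.update (fun k : ℕ => z.val (1 + (k : ℤ) - n - m - 1).toNat) p e,
        fun k hk => h1 _ (by omega), ?_, ?_, fun k hk => ?_⟩)
      · rw [Function.update_self, tailFrom_val, hpm, h4]
      · rw [Function.update_self, tailFrom_val, hpm, h5]
      · rw [Function.update_of_ne (by omega)]
        exact h3' _ (by omega)

/-- A single level whose tail starts at or before `B` already displays the flip; below `B` nothing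
changes. Since `ξ` is injective on vertices, paths of lifted edges descend to paths in `H`. -/
theorem tailFlip_of_bddBelow (h0 : (ξ 0).onV = (ξ 1).onV)
    (h1 : range (ξ 0).onE ∩ range (ξ 1).onE = ∅) {x y : TwoSided G} {B : ℤ}
    (hB : ∀ j, j ≤ B → x.val j = y.val j) (hne : x ≠ y)
    (h : ∀ n, Rel ξ (tailFrom x n) (tailFrom y n)) : TailFlip ξ x y := by
  obtain ⟨n, hn⟩ : ∃ n : ℕ, 1 - (n : ℤ) ≤ B := ⟨(1 - B).toNat, by omega⟩
  have hv : ∀ j : ℤ, 1 - (n : ℤ) ≤ j → ∀ w : TwoSided G,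
      w.val j = (tailFrom w n).val (j - 1 + n).toNat := fun j hj w => by
    rw [tailFrom_val]
    congr 1
    omega
  have hagree : ∀ p : ℕ, (∀ k, k < p → (tailFrom x n).val k = (tailFrom y n).val k) →
      ∀ j : ℤ, j < 1 + (p : ℤ) - n → x.val j = y.val j := by
    intro p hp j hj
    rcases le_total j B with hjB | hjB
    · exact hB j hjB
    · rw [hv j (by omega), hv j (by omega)]
      exact hp _ (by omega)
  rcases h n with he | ⟨p, i, z, h2, h3, h4, h5⟩ | ⟨p, i, z, h2, h3, h4⟩
  · refine absurd (TwoSided.ext (funext fun j => ?_)) hne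
    rcases le_total j B with hjB | hjB
    · exact hB j hjB
    · rw [hv j (by omega), hv j (by omega), he]
  · have h5' : ∀ k : ℕ, x.val (1 + (p : ℤ) - n + 1 + k) = (ξ i).onE (z (p + 1 + k)) ∧
        y.val (1 + (p : ℤ) - n + 1 + k) = (ξ (1 - i)).onE (z (p + 1 + k)) := fun k => by
      have := h5 (p + 1 + k) (by omega)
      rwa [tailFrom_val, tailFrom_val, show 1 + ((p + 1 + k : ℕ) : ℤ) - n =
        1 + (p : ℤ) - n + 1 + k by push_cast; ring] at this
    refine ⟨1 + (p : ℤ) - n, i, ⟨fun k => z (p + 1 + k), fun k => ?_⟩, hagree p h2,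
      Or.inr ⟨z p, ?_, h3, h4⟩, h5'⟩
    · have := x.isPath (1 + (p : ℤ) - n + 1 + k)
      rw [(h5' k).1, show 1 + (p : ℤ) - n + 1 + k + 1 = 1 + (p : ℤ) - n + 1 + (k + 1 : ℕ) by
        push_cast; ring, (h5' (k + 1)).1] at this
      exact composable_of_onE h0 this
    · have := x.isPath (1 + (p : ℤ) - n)
      have h6 := (h5' 0).1
      rw [Nat.cast_zero, add_zero] at h6
      rw [h6, ← tailFrom_val, h3] at this
      exact composable_of_onE h0 this
  · cases p with
    | zero =>
      -- Here the flip would start at coordinate `1 - n ≤ B`, where the paths agree.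
      have h5 := h4 0 le_rfl
      have h6 : (tailFrom x n).val 0 = (tailFrom y n).val 0 := hB _ (by simpa using hn)
      exact absurd (onE_inj ξ h1 (h5.1.symm.trans (h6.trans h5.2))).1.symm (fin_two_one_sub_ne i)
    | succ p =>
      have h5' : ∀ k : ℕ, x.val (1 + (p : ℤ) - n + 1 + k) = (ξ i).onE (z (p + 1 + k)) ∧
          y.val (1 + (p : ℤ) - n + 1 + k) = (ξ (1 - i)).onE (z (p + 1 + k)) := fun k => by
        have := h4 (p + 1 + k) (by omega)
        rwa [tailFrom_val, tailFrom_val, show 1 + ((p + 1 + k : ℕ) : ℤ) - n =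
          1 + (p : ℤ) - n + 1 + k by push_cast; ring] at this
      refine ⟨1 + (p : ℤ) - n, i, ⟨fun k => z (p + 1 + k), fun k => ?_⟩,
        fun j hj => hagree (p + 1) h2 j (by push_cast; omega),
        Or.inl ⟨h2 p (by omega), h3 p rfl⟩, h5'⟩
      have := x.isPath (1 + (p : ℤ) - n + 1 + k)
      rw [(h5' k).1, show 1 + (p : ℤ) - n + 1 + k + 1 = 1 + (p : ℤ) - n + 1 + (k + 1 : ℕ) by
        push_cast; ring, (h5' (k + 1)).1] at this
      exact composable_of_onE h0 this

/-- In a tail that starts at a difference, the flip has an empty common prefix, so everything after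
that coordinate is flipped. Such tails start arbitrarily far to the left. -/
theorem fullFlip_of_not_bddBelow (h0 : (ξ 0).onV = (ξ 1).onV)
    (h1 : range (ξ 0).onE ∩ range (ξ 1).onE = ∅) {x y : TwoSided G}
    (hB : ∀ B : ℤ, ∃ j, j ≤ B ∧ x.val j ≠ y.val j)
    (h : ∀ n, Rel ξ (tailFrom x n) (tailFrom y n)) : FullFlip ξ x y := by
  have key : ∀ B : ℤ, ∃ i : Fin 2, ∀ j, B < j →
      ∃ f, x.val j = (ξ i).onE f ∧ y.val j = (ξ (1 - i)).onE f := by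
    intro B
    obtain ⟨j, hj, hne⟩ := hB (min B 0)
    obtain ⟨n, hn⟩ := Int.eq_ofNat_of_zero_le (show 0 ≤ 1 - j by omega)
    have hv : ∀ l : ℤ, j ≤ l → ∀ w : TwoSided G,
        w.val l = (tailFrom w n).val (l - j).toNat := fun l hl w => by
      rw [tailFrom_val]
      congr 1
      omega
    rw [hv j le_rfl, hv j le_rfl, sub_self, Int.toNat_zero] at hne
    rcases h n with he | ⟨p, i, z, h2, -, -, h5⟩ | ⟨p, i, z, h2, -, h4⟩
    · exact absurd (by rw [he]) hne
    · have hp : p = 0 := by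
        by_contra hp
        exact hne (h2 0 (by omega))
      refine ⟨i, fun l hl => ⟨z (l - j).toNat, ?_⟩⟩
      rw [hv l (by omega), hv l (by omega)]
      exact h5 _ (by omega)
    · have hp : p = 0 := by
        by_contra hp
        exact hne (h2 0 (by omega))
      refine ⟨i, fun l hl => ⟨z (l - j).toNat, ?_⟩⟩
      rw [hv l (by omega), hv l (by omega)]
      exact h4 _ (by omega)
  obtain ⟨i, hi⟩ := key 0
  obtain ⟨f, hf, -⟩ := hi 1 (by omega)
  have hall : ∀ j, ∃ f, x.val j = (ξ i).onE f ∧ y.val j = (ξ (1 - i)).onE f := by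
    intro j
    obtain ⟨i', hi'⟩ := key (min (j - 1) 0)
    -- Coordinate `1` lies in the flipped range of every tail considered, so all of them have the
    -- same `i`.
    obtain ⟨f', hf', -⟩ := hi' 1 (by omega)
    obtain ⟨rfl, -⟩ := onE_inj ξ h1 (hf.symm.trans hf')
    exact hi' j (by omega)
  choose z hz using hall
  refine ⟨i, ⟨z, fun n => ?_⟩, hz⟩
  have := x.isPath n
  rw [(hz n).1, (hz (n + 1)).1] at this
  exact composable_of_onE h0 this

theorem flip_of_piTwo_eq (h0 : (ξ 0).onV = (ξ 1).onV)
    (h1 : range (ξ 0).onE ∩ range (ξ 1).onE = ∅) {x y : TwoSided G}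
    (h : piTwo ξ x = piTwo ξ y) (hne : x ≠ y) : FullFlip ξ x y ∨ TailFlip ξ x y := by
  rw [piTwo_eq_iff h1] at h
  by_cases hB : ∀ B : ℤ, ∃ j, j ≤ B ∧ x.val j ≠ y.val j
  · exact Or.inl (fullFlip_of_not_bddBelow h0 h1 hB h)
  · push Not at hB
    obtain ⟨B, hB⟩ := hB
    exact Or.inr (tailFlip_of_bddBelow h0 h1 hB hne h)

theorem eventuallyFlipped_of_piTwo_eq (h0 : (ξ 0).onV = (ξ 1).onV)
    (h1 : range (ξ 0).onE ∩ range (ξ 1).onE = ∅) {x y : TwoSided G}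
    (h : piTwo ξ x = piTwo ξ y) (hne : x ≠ y) :
    EventuallyFlipped ξ (tailFrom x 0).val (tailFrom y 0).val :=
  (flip_of_piTwo_eq h0 h1 h hne).elim FullFlip.eventuallyFlipped TailFlip.eventuallyFlipped

theorem EventuallyFlipped.ne (h1 : range (ξ 0).onE ∩ range (ξ 1).onE = ∅) {x y : TwoSided G}
    (h : EventuallyFlipped ξ (tailFrom x 0).val (tailFrom y 0).val) : x ≠ y := by
  rintro rfl
  obtain ⟨M, hM⟩ := h.exists_ne h1
  exact hM M le_rfl rfl

theorem FullFlip.not_tailFlip (h1 : range (ξ 0).onE ∩ range (ξ 1).onE = ∅) {x y : TwoSided G}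
    (h : FullFlip ξ x y) : ¬ TailFlip ξ x y := by
  rintro ⟨m, -, -, hm, -⟩
  obtain ⟨i, z, h⟩ := h
  have := hm (m - 1) (by omega)
  rw [(h _).1, (h _).2] at this
  exact fin_two_one_sub_ne i (onE_inj ξ h1 this).1.symm

theorem piTwo_eq_iff_exactlyOne (h0 : (ξ 0).onV = (ξ 1).onV)
    (h1 : range (ξ 0).onE ∩ range (ξ 1).onE = ∅) (x y : TwoSided G) :
    piTwo ξ x = piTwo ξ y ↔ ExactlyOne (x = y) (FullFlip ξ x y) (TailFlip ξ x y) := by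
  constructor
  · intro h
    by_cases hxy : x = y
    · exact Or.inl ⟨hxy, fun h => h.eventuallyFlipped.ne h1 hxy,
        fun h => h.eventuallyFlipped.ne h1 hxy⟩
    · rcases flip_of_piTwo_eq h0 h1 h hxy with hf | hf
      · exact Or.inr (Or.inl ⟨hxy, hf, hf.not_tailFlip h1⟩)
      · exact Or.inr (Or.inr ⟨hxy, fun h => h.not_tailFlip h1 hf, hf⟩)
  · rintro (⟨rfl, -⟩ | ⟨-, h, -⟩ | ⟨-, -, h⟩)
    exacts [rfl, h.piTwo_eq, h.piTwo_eq]

theorem encard_fibre_le_two (h0 : (ξ 0).onV = (ξ 1).onV)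
    (h1 : range (ξ 0).onE ∩ range (ξ 1).onE = ∅) (p : InvLim ξ) :
    (piTwo ξ ⁻¹' {p}).encard ≤ 2 :=
  encard_le_two_of_eventuallyFlipped h1 (fun x => (tailFrom x 0).val) fun _ hx _ hy hne =>
    eventuallyFlipped_of_piTwo_eq h0 h1 (hx.trans hy.symm) hne

end Fibres

/-! ### Surjectivity of `π_ξ` by compactness. -/

section Surjectivity

open CategoryTheory in
theorem exists_section_of_finite {K : ℕ → Type*} [∀ n, Finite (K n)] [∀ n, Nonempty (K n)]
    (f : ∀ n, K (n + 1) → K n) : ∃ s : ∀ n, K n, ∀ n, f n (s (n + 1)) = s n := by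
  let F : ℕᵒᵖ ⥤ Type _ := Functor.ofOpSequence (X := K) (fun n => TypeCat.ofHom (f n))
  have h1 : ∀ j, Finite (F.obj j) := fun j => inferInstanceAs (Finite (K j.unop))
  have h2 : ∀ j, Nonempty (F.obj j) := fun j => inferInstanceAs (Nonempty (K j.unop))
  obtain ⟨s, hs⟩ := nonempty_sections_of_finite_inverse_system F
  refine ⟨fun n => s ⟨n⟩, fun n => ?_⟩
  have := hs (homOfLE (Nat.le_succ n)).op
  rw [Functor.ofOpSequence_map_homOfLE_succ] at this
  exact this

variable {W F V E : Type*} {H : EdgeGraph W F} {G : EdgeGraph V E} {ξ : Fin 2 → Embedding H G}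

/-- The one-sided fibres over the components of a point are nonempty, have at most two elements, and
are mapped to one another by the shift. A section of this inverse system is glued to a bi-infinite
path. -/
theorem piTwo_surjective (h1 : range (ξ 0).onE ∩ range (ξ 1).onE = ∅) :
    Function.Surjective (piTwo ξ) := by
  intro p
  let K : ℕ → Set (OneSided G) := fun n => {a | piPos ξ a = p.val n}
  have hfin : ∀ n, Finite (K n) := fun n =>
    Set.finite_of_encard_le_coe (k := 2) (encard_le_two_of_eventuallyFlipped h1
      OneSided.val fun _ hx _ hy hne =>
        ((piPos_eq_iff h1).1 (hx.trans hy.symm)).eventuallyFlipped hne)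
  have hne : ∀ n, Nonempty (K n) := fun n => ⟨Quot.out (p.val n), Quot.out_eq _⟩
  have hmap : ∀ n, ∀ a : K (n + 1), shiftPos a.1 ∈ K n := by
    rintro n ⟨a, ha⟩
    change piPos ξ (shiftPos a) = p.val n
    rw [p.compat, ← ha]
    rfl
  obtain ⟨s, hs⟩ := exists_section_of_finite (K := fun n => K n)
    fun n a => ⟨shiftPos a.1, hmap n a⟩
  obtain ⟨x, hx⟩ := exists_twoSided (fun n => (s n).1) fun n => congrArg Subtype.val (hs n)
  refine ⟨x, InvLim.ext (funext fun n => ?_)⟩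
  exact (congrArg (piPos ξ) (hx n)).trans (s n).2

end Surjectivity

/-! ### Compatibility with the brackets. -/

section Bracket

variable {W F V E : Type*} {H : EdgeGraph W F} {G : EdgeGraph V E} {ξ : Fin 2 → Embedding H G}
  [Fintype V] [DecidableEq V]

/-- The scale `2⁻³` makes `u = [x, y]` equal to `y` up to coordinate `3`. Its `n`-th tail then
agrees with that of `y` in `n + 3` entries, and `3·2⁻ⁿ⁻³ ≤ 2⁻ⁿ⁻¹`. For uniqueness, codes are lifted
one preimage at a time: distance below `1` fixes the new class, and the angles of the two candidates
are within `1/4 + 1/16 < 1/2`, which excludes the other half of the doubled angle. -/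
theorem isBracket_iff (hξ : StandingHypotheses ξ) (hH : Nonempty (TwoSided H)) {x y : TwoSided G}
    (hxy : dTwo x y ≤ (2 : ℝ)⁻¹ ^ 3) (h : dTwo x y ≤ 2⁻¹) (z : InvLim ξ) :
    IsBracket ξ hξ.h0 (piTwo ξ x) (piTwo ξ y) z ↔ z = piTwo ξ (bracketTwo x y h) := by
  have heq : ∀ j : ℤ, -2 ≤ j → j ≤ 3 → x.val j = y.val j := fun j hj hj' =>
    eq_of_dTwo_lt (N := 2) (hxy.trans_lt (by norm_num)) j (by simpa using hj) (by simpa using hj')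
  have hu : ∀ j : ℤ, j ≤ 3 → (bracketTwo x y h).val j = y.val j := by
    intro j hj
    simp only [bracketTwo]
    split_ifs with h0
    · rfl
    · exact heq j (by omega) hj
  have hu0 : tailFrom (bracketTwo x y h) 0 = tailFrom x 0 := by
    ext k
    simp only [tailFrom, bracketTwo]
    rw [if_neg (by push_cast; omega)]
  have hagree : ∀ n : ℕ, Agree (n + 3) (tailFrom (bracketTwo x y h) n) (tailFrom y n) :=
    fun n k hk => hu _ (by omega)
  constructor
  · rintro ⟨-, hz0, hz⟩
    obtain ⟨w, rfl⟩ := piTwo_surjective hξ.h1 z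
    rw [piTwo_eq_iff hξ.h1]
    intro n
    rw [rel_iff_sameCode hξ.h1]
    induction n with
    | zero =>
      rw [hu0]
      exact (rel_iff_sameCode hξ.h1).1 ((piPos_eq_iff hξ.h1).1 hz0)
    | succ n ih =>
      have hd := hz (n + 1)
      rw [dQuot_piTwo hξ hH] at hd
      have hpow : (2 : ℝ)⁻¹ ^ (n + 1 + 1) ≤ 1 / 4 := by
        calc (2 : ℝ)⁻¹ ^ (n + 1 + 1) ≤ 2⁻¹ ^ 2 :=
              pow_le_pow_of_le_one (by norm_num) (by norm_num) (by omega)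
          _ = 1 / 4 := by norm_num
      have hpow' : (2 : ℝ)⁻¹ ^ (n + 1 + 3) ≤ 1 / 16 := by
        calc (2 : ℝ)⁻¹ ^ (n + 1 + 3) ≤ 2⁻¹ ^ 4 :=
              pow_le_pow_of_le_one (by norm_num) (by norm_num) (by omega)
          _ = 1 / 16 := by norm_num
      rw [tailFrom_eq_shiftPos w, tailFrom_eq_shiftPos (bracketTwo x y h)] at ih
      refine ih.of_shift_of_dist_lt hξ.h1 ?_ ?_
      · rw [hagree (n + 1) 0 (by omega)]
        exact edgeClass_eq_of_dOne_lt_one hξ.h0 (by linarith)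
      · have h1 := dist_triangle_right (angle ξ (tailFrom w (n + 1)))
          (angle ξ (tailFrom (bracketTwo x y h) (n + 1))) (angle ξ (tailFrom y (n + 1)))
        have h2 := dist_angle_le ξ (hagree (n + 1))
        have h3 := dist_angle_le_dOne hξ.h0 (tailFrom w (n + 1)) (tailFrom y (n + 1))
        linarith
  · rintro rfl
    refine ⟨?_, congrArg (piPos ξ) hu0, fun n => ?_⟩
    · refine (dLim_le hξ hH (N := 3) fun j hj hj' => heq j ?_ ?_).trans (by norm_num)
      · push_cast at hj; omega
      · exact_mod_cast hj'
    · rw [dQuot_piTwo hξ hH]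
      refine (dOne_le_of_agree hξ.h0 (hagree n)).trans ?_
      have : (0 : ℝ) < 2⁻¹ ^ n := by positivity
      rw [pow_add, show (2 : ℝ)⁻¹ ^ 3 = 8⁻¹ by norm_num, pow_succ]
      linarith

end Bracket

/-! ### Stable sets and continuity for the metrics. -/

section Stable

variable {W F V E : Type*} {H : EdgeGraph W F} {G : EdgeGraph V E} {ξ : Fin 2 → Embedding H G}

/-- The exchange of `ξ⁰(y)` and `ξ¹(y)`. -/
theorem exists_edge_swap (h0 : (ξ 0).onV = (ξ 1).onV)
    (h1 : range (ξ 0).onE ∩ range (ξ 1).onE = ∅) :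
    ∃ sw : E → E, (∀ e, e ∉ imageEdges ξ → sw e = e) ∧
      (∀ i f, sw ((ξ i).onE f) = (ξ (1 - i)).onE f) ∧
      ∀ e, G.i (sw e) = G.i e ∧ G.t (sw e) = G.t e := by
  have : ∀ e : E, ∃ e', (e ∉ imageEdges ξ → e' = e) ∧
      (∀ i f, e = (ξ i).onE f → e' = (ξ (1 - i)).onE f) ∧ G.i e' = G.i e ∧ G.t e' = G.t e := by
    intro e
    by_cases he : e ∈ imageEdges ξ
    · obtain ⟨i, f, rfl⟩ := (mem_imageEdges ξ).1 he
      refine ⟨(ξ (1 - i)).onE f, fun h => absurd he h, fun j g hjg => ?_, ?_, ?_⟩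
      · obtain ⟨rfl, rfl⟩ := onE_inj ξ h1 hjg
        rfl
      · rw [(ξ _).map_i, (ξ i).map_i, onV_eq h0 (1 - i) i]
      · rw [(ξ _).map_t, (ξ i).map_t, onV_eq h0 (1 - i) i]
    · exact ⟨e, fun _ => rfl, fun i f hf => absurd ((mem_imageEdges ξ).2 ⟨i, f, hf⟩) he, rfl, rfl⟩
  choose sw h2 h3 h4 using this
  exact ⟨sw, h2, fun i f => h3 _ i f rfl, h4⟩

/-- If `w` is eventually flipped with respect to `x`, then the fibre of `w` contains a path that
is eventually equal to `x`. -/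
theorem exists_piTwo_eq_of_flipped (h0 : (ξ 0).onV = (ξ 1).onV)
    (h1 : range (ξ 0).onE ∩ range (ξ 1).onE = ∅) {x w : TwoSided G} {M : ℤ} {i : Fin 2}
    (h : ∀ j, M ≤ j → ∃ f, x.val j = (ξ i).onE f ∧ w.val j = (ξ (1 - i)).onE f) :
    ∃ y : TwoSided G, (∃ M' : ℤ, ∀ j, M' ≤ j → x.val j = y.val j) ∧ piTwo ξ w = piTwo ξ y := by
  obtain ⟨sw, hs1, hs2, hs3⟩ := exists_edge_swap h0 h1
  have hx : ∀ j, M ≤ j → x.val j = sw (w.val j) := by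
    intro j hj
    obtain ⟨f, hf, hf'⟩ := h j hj
    rw [hf', hs2, fin_two_one_sub_one_sub, hf]
  -- If all of `w` consists of lifts by `ξ^{1-i}`, the full flip of `w` is the required point.
  by_cases hall : ∀ j, ∃ f, w.val j = (ξ (1 - i)).onE f
  · choose z hz using hall
    refine ⟨⟨fun j => sw (w.val j), fun j => ?_⟩, ⟨M, hx⟩, FullFlip.piTwo_eq
      ⟨1 - i, ⟨z, fun j => ?_⟩, fun j => ⟨hz j, ?_⟩⟩⟩
    · rw [(hs3 _).1, (hs3 _).2, w.isPath]
    · have := w.isPath j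
      rw [hz, hz] at this
      exact composable_of_onE h0 this
    · simp only [hz, hs2]
  · push Not at hall
    -- Otherwise `w` is swapped from the last coordinate `m` on that is not such a lift. Either
    -- `w_m` is outside `ξ(H¹)` and is fixed by the swap, or it is a lift by `ξ^i`, the opposite
    -- digit that `TailFlip` asks for.
    obtain ⟨m, hm, hmax⟩ := Int.exists_greatest_of_bdd
      (P := fun j => ∀ f, w.val j ≠ (ξ (1 - i)).onE f) ⟨M, fun j hj => by
        by_contra hlt
        obtain ⟨f, -, hf⟩ := h j (by omega)
        exact hj f hf⟩ hall
    have hz : ∀ k : ℕ, ∃ f, w.val (m + 1 + k) = (ξ (1 - i)).onE f := by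
      intro k
      by_contra! hk
      have := hmax _ hk
      omega
    choose z hz using hz
    have hpath : ∀ k, H.t (z k) = H.i (z (k + 1)) := by
      intro k
      have := w.isPath (m + 1 + k)
      rw [hz, show m + 1 + (k : ℤ) + 1 = m + 1 + (k + 1 : ℕ) by push_cast; ring, hz] at this
      exact composable_of_onE h0 this
    refine ⟨⟨fun j => if j < m then w.val j else sw (w.val j), fun j => ?_⟩,
      ⟨max M m, fun j hj => ?_⟩, TailFlip.piTwo_eq
      ⟨m, 1 - i, ⟨z, hpath⟩, fun j hj => (if_pos hj).symm, ?_, fun k => ⟨hz k, ?_⟩⟩⟩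
    · split_ifs <;> simp only [(hs3 _).1, (hs3 _).2, w.isPath]
    · exact (hx j (by omega)).trans (if_neg (by omega)).symm
    · simp only [lt_irrefl, if_false]
      by_cases hmem : w.val m ∈ imageEdges ξ
      · obtain ⟨j, e, he⟩ := (mem_imageEdges ξ).1 hmem
        have hj : j = i := by
          by_contra hj
          rw [fin_two_eq_one_sub_of_ne hj] at he
          exact hm e he
        subst hj
        refine Or.inr ⟨e, ?_, ?_, ?_⟩
        · have := w.isPath m
          have h2 := hz 0
          rw [Nat.cast_zero, add_zero] at h2
          rw [he, h2] at this
          exact composable_of_onE h0 this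
        · rw [fin_two_one_sub_one_sub, he]
        · rw [he, hs2]
      · exact Or.inl ⟨(hs1 _ hmem).symm, hmem⟩
    · simp only
      rw [if_neg (by omega), hz, hs2]

variable [Fintype V] [DecidableEq V]

theorem mem_stableSet_piTwo (hξ : StandingHypotheses ξ) (hH : Nonempty (TwoSided H))
    {x y : TwoSided G} (h : y ∈ stableSet dTwo shiftTwo x) :
    piTwo ξ y ∈ stableSet (dLim ξ hξ.h0) (shiftLim ξ) (piTwo ξ x) := by
  obtain ⟨M, hM⟩ := mem_stableSet_dTwo_iff.1 h
  simp only [stableSet, mem_ofPred_eq, piTwo_iterate_shiftTwo]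
  refine squeeze_zero' (g := fun n : ℕ => 3 * (2 : ℝ)⁻¹ ^ (n - M.toNat))
    (Eventually.of_forall fun n => dLim_nonneg hξ hH _ _) ?_ ?_
  · filter_upwards [eventually_ge_atTop M.toNat] with n hn
    refine dLim_le hξ hH fun j hj _ => ?_
    rw [iterate_shiftTwo_val, iterate_shiftTwo_val]
    exact hM _ (by omega)
  · rw [← mul_zero (3 : ℝ)]
    exact ((tendsto_pow_atTop_nhds_zero_of_lt_one (by norm_num) (by norm_num)).comp
      (tendsto_sub_atTop_nat _)).const_mul 3

/-- Once the distance stays below `1/4`, the zeroth components have equal classes and angles within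
the expansiveness constant at all later times. -/
theorem exists_rel_of_mem_stableSet (hξ : StandingHypotheses ξ) (hH : Nonempty (TwoSided H))
    {x w : TwoSided G} (h : piTwo ξ w ∈ stableSet (dLim ξ hξ.h0) (shiftLim ξ) (piTwo ξ x)) :
    ∃ N, Rel ξ (shiftPos^[N] (tailFrom x 0)) (shiftPos^[N] (tailFrom w 0)) := by
  simp only [stableSet, mem_ofPred_eq, piTwo_iterate_shiftTwo] at h
  obtain ⟨N, hN⟩ := eventually_atTop.1 ((tendsto_order.1 h).2 (1 / 4) (by norm_num))
  have hd : ∀ n, N ≤ n →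
      dOne hξ.h0 (shiftPos^[n] (tailFrom x 0)) (shiftPos^[n] (tailFrom w 0)) < 1 / 4 := by
    intro n hn
    have := (dOne_le_dLim hξ hH _ _).trans_lt (hN n hn)
    rwa [tailFrom_iterate_shiftTwo, tailFrom_iterate_shiftTwo] at this
  refine ⟨N, (rel_iff_sameCode hξ.h1).2 (SameCode.of_dist_le hξ.h1 (fun n => ?_) fun n => ?_)⟩
  · have := edgeClass_eq_of_dOne_lt_one hξ.h0 ((hd (n + N) (by omega)).trans (by norm_num))
    rw [iterate_shiftPos_val, iterate_shiftPos_val, zero_add] at this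
    rwa [iterate_shiftPos_val, iterate_shiftPos_val]
  · rw [← Function.iterate_add_apply, ← Function.iterate_add_apply]
    exact (dist_angle_le_dOne hξ.h0 _ _).trans (hd (n + N) (by omega)).le

theorem bijOn_stableSet (hξ : StandingHypotheses ξ) (hH : Nonempty (TwoSided H))
    (x : TwoSided G) :
    Set.BijOn (piTwo ξ) (stableSet dTwo shiftTwo x)
      (stableSet (dLim ξ hξ.h0) (shiftLim ξ) (piTwo ξ x)) := by
  refine ⟨fun y hy => mem_stableSet_piTwo hξ hH hy, fun y hy y' hy' h => ?_, fun p hp => ?_⟩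
  · by_contra hne
    obtain ⟨M, hM⟩ := mem_stableSet_dTwo_iff.1 hy
    obtain ⟨M', hM'⟩ := mem_stableSet_dTwo_iff.1 hy'
    -- Both points are eventually equal to `x`, whereas distinct points of one fibre eventually
    -- differ everywhere.
    obtain ⟨L, hL⟩ := (eventuallyFlipped_of_piTwo_eq hξ.h0 hξ.h1 h hne).exists_ne hξ.h1
    refine hL (L + M.toNat + M'.toNat) (by omega) ?_
    rw [tailFrom_val, tailFrom_val, ← hM _ (by push_cast; omega), ← hM' _ (by push_cast; omega)]
  · obtain ⟨w, rfl⟩ := piTwo_surjective hξ.h1 p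
    obtain ⟨N, hN⟩ := exists_rel_of_mem_stableSet hξ hH hp
    have hv : ∀ (v : TwoSided G) (k : ℕ),
        (shiftPos^[N] (tailFrom v 0)).val k = v.val (1 + k + N) := by
      intro v k
      rw [iterate_shiftPos_val, tailFrom_val]
      congr 1
      push_cast
      ring
    -- If the related tails coincide, `w` itself is stably equivalent to `x`; otherwise the other
    -- point of its fibre is.
    by_cases heq : shiftPos^[N] (tailFrom x 0) = shiftPos^[N] (tailFrom w 0)
    · refine ⟨w, mem_stableSet_dTwo_iff.2 ⟨1 + N, fun j hj => ?_⟩, rfl⟩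
      obtain ⟨k, hk⟩ := Int.eq_ofNat_of_zero_le (show 0 ≤ j - 1 - N by omega)
      obtain rfl : j = 1 + k + N := by omega
      rw [← hv, ← hv, heq]
    · obtain ⟨M, i, hM⟩ := hN.eventuallyFlipped heq
      obtain ⟨y, hy, hwy⟩ := exists_piTwo_eq_of_flipped hξ.h0 hξ.h1 (x := x) (w := w)
        (M := 1 + M + N) (i := i) fun j hj => by
          obtain ⟨k, hk⟩ := Int.eq_ofNat_of_zero_le (show 0 ≤ j - 1 - N by omega)
          obtain rfl : j = 1 + k + N := by omega
          rw [← hv, ← hv]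
          exact hM k (by omega)
      exact ⟨y, mem_stableSet_dTwo_iff.2 hy, hwy.symm⟩

theorem exists_delta_dLim_lt (hξ : StandingHypotheses ξ) (hH : Nonempty (TwoSided H))
    (x : TwoSided G) {η : ℝ} (hη : 0 < η) : ∃ δ : ℝ, 0 < δ ∧ ∀ y : TwoSided G,
      dTwo x y < δ → dLim ξ hξ.h0 (piTwo ξ x) (piTwo ξ y) < η := by
  obtain ⟨N, hN⟩ := exists_pow_lt_of_lt_one (div_pos hη (by norm_num : (0 : ℝ) < 3))
    (by norm_num : (2 : ℝ)⁻¹ < 1)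
  refine ⟨(2 : ℝ)⁻¹ ^ N, by positivity, fun y hy => ?_⟩
  refine (dLim_le hξ hH (N := N) fun j hj hj' =>
    eq_of_dTwo_lt hy j (by omega) (by omega)).trans_lt ?_
  linarith

end Stable

end XiFactor

theorem theorem4p3 {W F V E : Type*} [Finite W] [Finite F] [Fintype V] [DecidableEq V] [Finite E]
    (H : XiFactor.EdgeGraph W F) (G : XiFactor.EdgeGraph V E)
    (ξ : Fin 2 → XiFactor.Embedding H G)
    (hξ : XiFactor.StandingHypotheses ξ)
    (hH : Nonempty (XiFactor.TwoSided H)) :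
    -- `π_ξ` is a factor map
    (Continuous (XiFactor.piTwo ξ) ∧
      (∀ x : XiFactor.TwoSided G, ∀ η : ℝ, 0 < η → ∃ δ : ℝ, 0 < δ ∧ ∀ y : XiFactor.TwoSided G,
        XiFactor.dTwo x y < δ →
          XiFactor.dLim ξ hξ.h0 (XiFactor.piTwo ξ x) (XiFactor.piTwo ξ y) < η) ∧
      Function.Surjective (XiFactor.piTwo ξ) ∧
      ∀ x : XiFactor.TwoSided G,
        XiFactor.piTwo ξ (XiFactor.shiftTwo x) = XiFactor.shiftLim ξ (XiFactor.piTwo ξ x)) ∧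
    -- both brackets are defined for `d_G(x, y) ≤ 2⁻³`, and `π_ξ` commutes with them
    (∀ x y : XiFactor.TwoSided G, XiFactor.dTwo x y ≤ (2 : ℝ)⁻¹ ^ 3 →
      ∃ h : XiFactor.dTwo x y ≤ 2⁻¹, ∀ z : XiFactor.InvLim ξ,
        XiFactor.IsBracket ξ hξ.h0 (XiFactor.piTwo ξ x) (XiFactor.piTwo ξ y) z ↔
          z = XiFactor.piTwo ξ (XiFactor.bracketTwo x y h)) ∧
    -- pairs with the same image, and the size of the fibres
    (∀ x y : XiFactor.TwoSided G, XiFactor.piTwo ξ x = XiFactor.piTwo ξ y ↔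
      XiFactor.ExactlyOne (x = y) (XiFactor.FullFlip ξ x y) (XiFactor.TailFlip ξ x y)) ∧
    (∀ p : XiFactor.InvLim ξ, (XiFactor.piTwo ξ ⁻¹' {p}).encard ≤ 2) ∧
    -- `π_ξ` is `s`-bijective
    (∀ x : XiFactor.TwoSided G,
      Set.BijOn (XiFactor.piTwo ξ)
        (XiFactor.stableSet XiFactor.dTwo XiFactor.shiftTwo x)
        (XiFactor.stableSet (XiFactor.dLim ξ hξ.h0) (XiFactor.shiftLim ξ)
          (XiFactor.piTwo ξ x))) := by
  refine ⟨⟨XiFactor.continuous_piTwo, fun x η hη => XiFactor.exists_delta_dLim_lt hξ hH x hη,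
    XiFactor.piTwo_surjective hξ.h1, XiFactor.piTwo_shiftTwo⟩, fun x y hxy => ?_,
    XiFactor.piTwo_eq_iff_exactlyOne hξ.h0 hξ.h1, XiFactor.encard_fibre_le_two hξ.h0 hξ.h1,
    XiFactor.bijOn_stableSet hξ hH⟩
  have h : XiFactor.dTwo x y ≤ 2⁻¹ := hxy.trans (by norm_num)
  exact ⟨h, XiFactor.isBracket_iff hξ hH hxy h⟩
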